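/- Let $K$ be a field of characteristic $0$ and let $V$ be a finite-dimensional $K$-vector space. An open Jacobi diagram is a finite uni-trivalent graph (loops and multiple edges allowed), equipped with a cyclic order of the three edge-ends at each trivalent vertex, such that every connected component contains at least one univalent vertex; it is $V$-colored if each univalent vertex carries an element of $V$. Its degree is half its number of vertices. Let $B_d$ be the $K$-vector space spanned by (isomorphism classes of) $V$-colored open Jacobi diagrams of degree $d$ modulo the AS relation (reversing the cyclic order at one trivalent vertex changes the sign), the IHX relation and multilinearity in the color of each univalent vertex. The group $\mathrm{GL}(V)$ acts on $B_d$ by its standard action on each color. Let $B_{d,k}\subset B_d$ be the $\mathrm{GL}(V)$-submodule spanned by the diagrams with exactly $k$ trivalent vertices, and $B_{d,k}^c\subset B_{d,k}$ the subspace spanned by the connected ones. For a partition $\lambda$ of $N$ let $\mathbb S_\lambda V=V^{\otimes N}\cdot c_\lambda$, where $c_\lambda\in K\mathfrak S_N$ is the Young symmetrizer, which acts by permuting the tensor factors. Then $B_2=B_{2,0}\oplus B_{2,1}\oplus B_{2,2}$ (internal direct sum), and as $\mathrm{GL}(V)$-modules $$B_{2,0}\cong \mathbb S_{(4)}V\oplus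 \mathbb S_{(2,2)}V,\qquad B_{2,1}=B_{2,1}^c\cong \mathbb S_{(1,1,1)}V,\qquad B_{2,2}=B_{2,2}^c\cong \mathbb S_{(2)}V.$$ -/

import Mathlib

noncomputable section

namespace JacobiDiagram

/-! ### Open Jacobi diagrams

A vertex-oriented uni-trivalent graph with `m` univalent vertices (labelled by `Fin m`) and `k`
trivalent vertices (labelled by `Fin k`) is encoded by its half-edges: one half-edge at each
univalent vertex, and three half-edges `(w, 0)`, `(w, 1)`, `(w, 2)` at each trivalent vertex `w`, in
this cyclic order.  The edges are given by a fixed-point free involution on the half-edges.  The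
labels only serve to present the graph; they are divided out by `OpenJacobiDiagram.Iso` below. -/

/-- The half-edges of a uni-trivalent graph with `m` univalent and `k` trivalent vertices. -/
abbrev HalfEdge (m k : ℕ) : Type := Fin m ⊕ (Fin k × Fin 3)

/-- The vertex at which a half-edge sits. -/
def HalfEdge.vertex {m k : ℕ} : HalfEdge m k → Fin m ⊕ Fin k :=
  Sum.map id Prod.fst

/-- The adjacency graph (forgetting loops and multiplicities, which do not affect connectedness) of
the uni-trivalent graph whose edges are the pairs `{h, e h}`. -/
def adjacencyGraph {m k : ℕ} (e : HalfEdge m k → HalfEdge m k) : SimpleGraph (Fin m ⊕ Fin k) :=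
  SimpleGraph.fromRel fun v w => ∃ h, HalfEdge.vertex h = v ∧ HalfEdge.vertex (e h) = w

/-- A (presentation of a) `C`-colored open Jacobi diagram with `m` univalent and `k` trivalent
vertices: a vertex-oriented uni-trivalent graph, possibly with loops and multiple edges, such that
each connected component has at least one univalent vertex, together with a color in `C` for each
univalent vertex. -/
structure OpenJacobiDiagram (C : Type*) (m k : ℕ) where
  /-- The involution matching the two half-edges of each edge. -/
  edge : Equiv.Perm (HalfEdge m k)
  edge_edge : ∀ h, edge (edge h) = h
  edge_ne : ∀ h, edge h ≠ h
  /-- The color of each univalent vertex. -/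
  color : Fin m → C
  /-- Every vertex lies in the connected component of some univalent vertex. -/
  exists_univalent : ∀ v, ∃ u : Fin m, (adjacencyGraph edge).Reachable v (Sum.inl u)

namespace OpenJacobiDiagram

variable {C C' : Type*} {m k : ℕ}

/-- The same graph with other colors. -/
def withColor (D : OpenJacobiDiagram C m k) (c : Fin m → C') : OpenJacobiDiagram C' m k where
  edge := D.edge
  edge_edge := D.edge_edge
  edge_ne := D.edge_ne
  color := c
  exists_univalent := D.exists_univalent

/-- Apply a function to all colors. -/
def mapColor (f : C → C') (D : OpenJacobiDiagram C m k) : OpenJacobiDiagram C' m k :=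
  D.withColor (f ∘ D.color)

/-- The underlying graph is connected. -/
def IsConnected (D : OpenJacobiDiagram C m k) : Prop :=
  (adjacencyGraph D.edge).Connected

/-- Isomorphism of colored open Jacobi diagrams: bijections `α` of the univalent vertices and `β`
of the half-edges at trivalent vertices which respect the cyclic orders at the trivalent vertices
(so that `β` induces a bijection of the trivalent vertices), the edges and the colors. -/
def Iso (D D' : OpenJacobiDiagram C m k) : Prop :=
  ∃ (α : Equiv.Perm (Fin m)) (β : Equiv.Perm (Fin k × Fin 3)),
    (∀ w i, β (w, i + 1) = ((β (w, i)).1, (β (w, i)).2 + 1)) ∧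
    (∀ h, D'.edge (Equiv.sumCongr α β h) = Equiv.sumCongr α β (D.edge h)) ∧
    ∀ u, D'.color (α u) = D.color u

/-- `D'` is obtained from `D` by moving, for each half-edge `h`, whatever is attached to the slot
`h` to the slot `ρ h`, keeping the colors. -/
def MovedBy (ρ : Equiv.Perm (HalfEdge m k)) (D D' : OpenJacobiDiagram C m k) : Prop :=
  D'.edge = ρ * D.edge * ρ⁻¹ ∧ D'.color = D.color

/-- The `i`-th half-edge at the trivalent vertex `w`. -/
abbrev slot (w : Fin k) (i : Fin 3) : HalfEdge m k := Sum.inr (w, i)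

/-- Interchange of two half-edges at `w`; this reverses the cyclic order at `w`. -/
def flip (w : Fin k) : Equiv.Perm (HalfEdge m k) :=
  Equiv.swap (slot w 1) (slot w 2)

/-- The three-cycle `(w, 1) ↦ (w, 2) ↦ (w', 1) ↦ (w, 1)` of slots. -/
def rotate (w w' : Fin k) : Equiv.Perm (HalfEdge m k) :=
  Equiv.swap (slot w 1) (slot w 2) * Equiv.swap (slot w 2) (slot w' 1)

end OpenJacobiDiagram

open OpenJacobiDiagram

/-! ### The spaces `B_d`, `B_{d,k}` and `B_{d,k}^c` -/

/-- Open Jacobi diagrams of degree `d`, i.e. with `2 d` vertices. -/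
abbrev DegreeDiagram (C : Type*) (d : ℕ) : Type _ :=
  Σ p : {p : ℕ × ℕ // p.1 + p.2 = 2 * d}, OpenJacobiDiagram C p.1.1 p.1.2

/-- A diagram with `m + k = 2 d` vertices, as a diagram of degree `d`. -/
def OpenJacobiDiagram.toDegree {C : Type*} {m k d : ℕ} (h : m + k = 2 * d)
    (D : OpenJacobiDiagram C m k) : DegreeDiagram C d :=
  ⟨⟨(m, k), h⟩, D⟩

section Space

variable (K : Type*) [Field K]

/-- A diagram as a basis vector of the free vector space on diagrams of degree `d`. -/
def basisVec {C : Type*} {m k d : ℕ} (h : m + k = 2 * d) (D : OpenJacobiDiagram C m k) :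
    DegreeDiagram C d →₀ K :=
  Finsupp.single (D.toDegree h) 1

variable (V : Type*) [AddCommGroup V] [Module K V]

/-- The relations among `V`-colored open Jacobi diagrams of degree `d`. -/
inductive Relator (d : ℕ) : (DegreeDiagram V d →₀ K) → Prop
  /-- Isomorphic diagrams are identified. -/
  | iso {m k : ℕ} (h : m + k = 2 * d) (D D' : OpenJacobiDiagram V m k) (hD : D.Iso D') :
      Relator d (basisVec K h D - basisVec K h D')
  /-- Antisymmetry: reversing the cyclic order at a trivalent vertex changes the sign. -/
  | antisymm {m k : ℕ} (h : m + k = 2 * d) (w : Fin k) (D D' : OpenJacobiDiagram V m k)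
      (hD : MovedBy (flip w) D D') :
      Relator d (basisVec K h D + basisVec K h D')
  /-- The IHX relation at an edge joining two distinct trivalent vertices `w` and `w'`: of the four
  other slots at `w` and `w'`, one is kept and what is attached to the other three is permuted
  cyclically.  With `(w', 2)` as root this reads `[[a, b], c] + [[c, a], b] + [[b, c], a] = 0`, i.e.
  `I - H + X = 0` up to antisymmetry. -/
  | ihx {m k : ℕ} (h : m + k = 2 * d) (w w' : Fin k) (hw : w ≠ w')
      (D₁ D₂ D₃ : OpenJacobiDiagram V m k) (he : D₁.edge (slot w 0) = slot w' 0)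
      (h₂ : MovedBy (rotate w w') D₁ D₂) (h₃ : MovedBy (rotate w w') D₂ D₃) :
      Relator d (basisVec K h D₁ + basisVec K h D₂ + basisVec K h D₃)
  /-- Multilinearity in the color of each univalent vertex. -/
  | multilinear {m k : ℕ} (h : m + k = 2 * d) (D : OpenJacobiDiagram V m k) (u : Fin m)
      (a b : K) (x y : V) :
      Relator d (basisVec K h (D.withColor (Function.update D.color u (a • x + b • y)))
        - a • basisVec K h (D.withColor (Function.update D.color u x))
        - b • basisVec K h (D.withColor (Function.update D.color u y)))

/-- The span of all relations in degree `d`. -/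
def relations (d : ℕ) : Submodule K (DegreeDiagram V d →₀ K) :=
  Submodule.span K {r | Relator K V d r}

/-- The space `B_d` of `V`-colored open Jacobi diagrams of degree `d` modulo the AS, IHX and
multilinearity relations. -/
abbrev B (d : ℕ) : Type _ := (DegreeDiagram V d →₀ K) ⧸ relations K V d

variable {K V}

/-- The class of a diagram in `B_d`. -/
def diagramClass {m k d : ℕ} (h : m + k = 2 * d) (D : OpenJacobiDiagram V m k) : B K V d :=
  (relations K V d).mkQ (basisVec K h D)

section Functoriality

variable {W : Type*} [AddCommGroup W] [Module K W]

/-- Applying a linear map to all colors, on the free vector space. -/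
def freeMap (d : ℕ) (f : V →ₗ[K] W) : (DegreeDiagram V d →₀ K) →ₗ[K] (DegreeDiagram W d →₀ K) :=
  Finsupp.lmapDomain K K fun D => ⟨D.1, D.2.mapColor f⟩

theorem freeMap_basisVec {m k d : ℕ} (f : V →ₗ[K] W) (h : m + k = 2 * d)
    (D : OpenJacobiDiagram V m k) :
    freeMap d f (basisVec K h D) = basisVec K h (D.mapColor f) := by
  simp [freeMap, basisVec, toDegree]

theorem mapColor_withColor_update {m k : ℕ} (f : V →ₗ[K] W) (D : OpenJacobiDiagram V m k)
    (u : Fin m) (x : V) :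
    (D.withColor (Function.update D.color u x)).mapColor f =
      (D.mapColor f).withColor (Function.update (D.mapColor f).color u (f x)) := by
  simp [mapColor, withColor, Function.comp_update]

theorem relations_le_comap (d : ℕ) (f : V →ₗ[K] W) :
    relations K V d ≤ (relations K W d).comap (freeMap d f) := by
  refine Submodule.span_le.2 fun r hr => ?_
  refine Submodule.subset_span (?_ : Relator K W d (freeMap d f r))
  cases hr with
  | iso h D D' hD =>
    rw [map_sub, freeMap_basisVec, freeMap_basisVec]
    obtain ⟨α, β, h₁, h₂, h₃⟩ := hD
    exact .iso h _ _ ⟨α, β, h₁, h₂, fun u => congrArg f (h₃ u)⟩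
  | antisymm h w D D' hD =>
    rw [map_add, freeMap_basisVec, freeMap_basisVec]
    exact .antisymm h w _ _ ⟨hD.1, congrArg (f ∘ ·) hD.2⟩
  | ihx h w w' hw D₁ D₂ D₃ he h₂ h₃ =>
    rw [map_add, map_add, freeMap_basisVec, freeMap_basisVec, freeMap_basisVec]
    exact .ihx h w w' hw _ _ _ he ⟨h₂.1, congrArg (f ∘ ·) h₂.2⟩ ⟨h₃.1, congrArg (f ∘ ·) h₃.2⟩
  | multilinear h D u a b x y =>
    simp only [map_sub, map_smul, freeMap_basisVec, mapColor_withColor_update, map_add]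
    exact .multilinear h _ u a b _ _

/-- The map `B_d(V) → B_d(W)` which applies a linear map to each color. -/
def B.map (d : ℕ) (f : V →ₗ[K] W) : B K V d →ₗ[K] B K W d :=
  Submodule.mapQ _ _ (freeMap d f) (relations_le_comap d f)

theorem B.map_diagramClass {m k d : ℕ} (f : V →ₗ[K] W) (h : m + k = 2 * d)
    (D : OpenJacobiDiagram V m k) :
    B.map d f (diagramClass h D) = diagramClass h (D.mapColor f) := by
  simp only [B.map, diagramClass, Submodule.mkQ_apply, Submodule.mapQ_apply, freeMap_basisVec]

end Functoriality

theorem B.ext_diagramClass {d : ℕ} {M : Type*} [AddCommGroup M] [Module K M]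
    {f g : B K V d →ₗ[K] M}
    (hfg : ∀ (m k : ℕ) (h : m + k = 2 * d) (D : OpenJacobiDiagram V m k),
      f (diagramClass h D) = g (diagramClass h D)) : f = g := by
  refine Submodule.linearMap_qext _ (Finsupp.lhom_ext' fun D => LinearMap.ext_ring ?_)
  exact hfg _ _ D.1.2 D.2

variable (K V)

/-- The `GL(V)`-module `B_d`: the standard action of `GL(V)` on each color. -/
def BRep (d : ℕ) : Representation K (LinearMap.GeneralLinearGroup K V) (B K V d) where
  toFun g := B.map d (g : V →ₗ[K] V)
  map_one' := B.ext_diagramClass fun m k h D => by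
    rw [B.map_diagramClass]; rfl
  map_mul' g g' := B.ext_diagramClass fun m k h D => by
    rw [B.map_diagramClass, Module.End.mul_apply, B.map_diagramClass, B.map_diagramClass]; rfl

/-- The `GL(V)`-submodule `B_{d,k}` of `B_d` spanned by the diagrams with exactly `k` trivalent
vertices. -/
def BGraded (d k : ℕ) : Subrepresentation (BRep K V d) where
  toSubmodule := Submodule.span K
    {x | ∃ (m : ℕ) (h : m + k = 2 * d) (D : OpenJacobiDiagram V m k), x = diagramClass h D}
  apply_mem_toSubmodule g v hv := by
    induction hv using Submodule.span_induction with
    | mem x hx =>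
      obtain ⟨m, h, D, rfl⟩ := hx
      exact Submodule.subset_span ⟨m, h, _, B.map_diagramClass _ h D⟩
    | zero => rw [map_zero]; exact zero_mem _
    | add x y _ _ hx hy => rw [map_add]; exact add_mem hx hy
    | smul a x _ hx => rw [map_smul]; exact Submodule.smul_mem _ a hx

/-- The connected part `B_{d,k}^c` of `B_{d,k}`: the span of the connected diagrams with exactly
`k` trivalent vertices. -/
def BConnected (d k : ℕ) : Submodule K (B K V d) :=
  Submodule.span K
    {x | ∃ (m : ℕ) (h : m + k = 2 * d) (D : OpenJacobiDiagram V m k),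
      D.IsConnected ∧ x = diagramClass h D}

end Space

/-! ### Schur functors

For a Young diagram `μ` with `N` cells, we label the factors of `V^{⊗ N}` by the cells of `μ`, and
let `𝔖_N` be the group of permutations of the cells. -/

section Schur

open scoped TensorProduct Classical

variable (K : Type*) [Field K]

/-- The Young symmetrizer `c_μ = a_μ b_μ`, where `a_μ` is the sum of all permutations preserving
each row of `μ` and `b_μ` is the signed sum of all permutations preserving each column. -/
def youngSymmetrizer (μ : YoungDiagram) : MonoidAlgebra K (Equiv.Perm μ.cells) :=
  (∑ σ : Equiv.Perm μ.cells with ∀ c, (σ c).1.1 = c.1.1, MonoidAlgebra.single σ (1 : K)) *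
    ∑ σ : Equiv.Perm μ.cells with ∀ c, (σ c).1.2 = c.1.2,
      MonoidAlgebra.single σ ((Equiv.Perm.sign σ : ℤ) : K)

variable (V : Type*) [AddCommGroup V] [Module K V]

/-- The right action of `a ∈ K 𝔖_N` on `V^{⊗ N}` by permutation of the factors, where
`(⊗_c v_c) · σ = ⊗_c v_{σ c}`. -/
def tensorRightMul {ι : Type*} (a : MonoidAlgebra K (Equiv.Perm ι)) :
    (⨂[K] _ : ι, V) →ₗ[K] (⨂[K] _ : ι, V) :=
  a.coeff.sum fun σ x => x • (PiTensorProduct.reindex K (fun _ : ι => V) σ⁻¹).toLinearMap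

/-- The `GL(V)`-module `V^{⊗ N}`. -/
def tensorRep (ι : Type*) :
    Representation K (LinearMap.GeneralLinearGroup K V) (⨂[K] _ : ι, V) where
  toFun g := PiTensorProduct.map fun _ => (g : V →ₗ[K] V)
  map_one' := PiTensorProduct.map_one
  map_mul' g g' := PiTensorProduct.map_mul (fun _ => (g : V →ₗ[K] V)) fun _ => (g' : V →ₗ[K] V)

theorem tensorRep_tensorRightMul {ι : Type*} (g : LinearMap.GeneralLinearGroup K V)
    (a : MonoidAlgebra K (Equiv.Perm ι)) (t : ⨂[K] _ : ι, V) :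
    tensorRep K V ι g (tensorRightMul K V a t) = tensorRightMul K V a (tensorRep K V ι g t) := by
  simp only [tensorRightMul, Finsupp.sum, LinearMap.sum_apply, map_sum, LinearMap.smul_apply,
    map_smul]
  refine Finset.sum_congr rfl fun σ _ => congrArg _ ?_
  exact PiTensorProduct.map_reindex (fun _ => (g : V →ₗ[K] V)) σ⁻¹ t

/-- The `GL(V)`-module `S_μ V = V^{⊗ N} · c_μ`. -/
def schur (μ : YoungDiagram) : Subrepresentation (tensorRep K V μ.cells) where
  toSubmodule := LinearMap.range (tensorRightMul K V (youngSymmetrizer K μ))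
  apply_mem_toSubmodule := by
    rintro g _ ⟨t, rfl⟩
    exact ⟨tensorRep K V _ g t, (tensorRep_tensorRightMul K V g _ t).symm⟩

/-- The `GL(V)`-module `S_λ V` for a partition `λ` given by its list of parts. -/
abbrev schurRep (parts : List ℕ) (h : parts.SortedGE) :
    Representation K (LinearMap.GeneralLinearGroup K V)
      (schur K V (YoungDiagram.ofRowLens parts h)).toSubmodule :=
  (schur K V (YoungDiagram.ofRowLens parts h)).toRepresentation

end Schur

end JacobiDiagram

end

/-! Each `B_{2,k}` is squeezed between a map `f` from a tensor power onto it and a map `g` back to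
that tensor power.

Upper bound. A loop at a trivalent vertex makes a diagram its own negative by AS. Among the
remaining diagrams, those with 0, 1 or 2 trivalent vertices are, up to sign, colorings of a single
graph: two struts, the tripod, or the wheel with two legs. With 3 trivalent vertices only one shape
survives (`earEdge`); a reflection of it reverses exactly one cyclic order, so it vanishes. With 4
there is no leg left. Hence `B_{2,k}` is the range of `f = colorings` and the three pieces span.
Only isomorphism, AS and multilinearity are needed here.

Lower bound. The `so(3)` weight system labels edges by `Fin 3` and multiplies Levi-Civita symbols
over the trivalent vertices; IHX holds because of the Jacobi identity. Prescribing the labels of the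
legs and summing over all matchings of tensor factors with legs gives an equivariant `g = B.weight`
that kills diagrams with the wrong number of legs. Then `g ∘ f` is right multiplication by an
element of the group algebra. For the leg labels `(0,0,1,1)`, `(0,1,2)`, `(0,0)` it is the sum over
a dihedral group of order 8, the signed sum over `𝔖_3`, and twice the sum over `𝔖_2`. The symmetries
of the graphs give `f ∘ g ∘ f = c • f` with `c = 8, 6, 4`, nonzero in characteristic 0. So `g` is
injective on `B_{2,k}`, which makes the sum direct and identifies `B_{2,k}` with the image of the
group algebra element.

The last two elements are multiples of Young symmetrizers. For two struts, let `D` be the dihedral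
sum, `S` the sum over `𝔖_4`, and `R`, `C` the row sum and signed column sum of the `2 × 2` square.
From `D C = 2 R C`, `D C D = 24 D - 8 S` and `S C = C S = 0` it follows that `V^{⊗4} D` splits into
`S_(4) V` and `S_(2,2) V`. -/

noncomputable section

namespace JacobiDiagram

open scoped TensorProduct
open OpenJacobiDiagram

/-! ### The right action of the group algebra on tensor powers. -/

section Tensor

variable (K : Type*) [Field K] (V : Type*) [AddCommGroup V] [Module K V]

/-- The element `∑ τ, w τ • τ` of the group algebra. -/
def groupSum {ι : Type*} [Fintype ι] [DecidableEq ι] (w : Equiv.Perm ι → ℤ) :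
    MonoidAlgebra K (Equiv.Perm ι) :=
  ∑ τ, MonoidAlgebra.single τ (w τ : K)

/-- Convolution of integer-valued functions on a symmetric group. -/
def conv {ι : Type*} [Fintype ι] [DecidableEq ι] (w w' : Equiv.Perm ι → ℤ) (g : Equiv.Perm ι) : ℤ :=
  ∑ τ, w τ * w' (τ⁻¹ * g)

theorem groupSum_mul {ι : Type*} [Fintype ι] [DecidableEq ι] (w w' : Equiv.Perm ι → ℤ) :
    groupSum K w * groupSum K w' = groupSum K (conv w w') := by
  have h (τ : Equiv.Perm ι) : ∑ x, MonoidAlgebra.single (τ * x) ((w τ : K) * (w' x : K)) =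
      ∑ g, MonoidAlgebra.single g ((w τ : K) * (w' (τ⁻¹ * g) : K)) :=
    Fintype.sum_equiv (Equiv.mulLeft τ) _ _ fun x => by simp
  simp only [groupSum, conv, Finset.sum_mul_sum, MonoidAlgebra.single_mul_single, h]
  rw [Finset.sum_comm]
  refine Finset.sum_congr rfl fun g _ => ?_
  push_cast
  exact (map_sum (MonoidAlgebra.singleAddHom (R := K) g) _ _).symm

variable {K V}

theorem tensorRightMul_add {ι : Type*} (a b : MonoidAlgebra K (Equiv.Perm ι)) :
    tensorRightMul K V (a + b) = tensorRightMul K V a + tensorRightMul K V b :=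
  Finsupp.sum_add_index' (by simp) (by simp [add_smul])

theorem tensorRightMul_smul {ι : Type*} (r : K) (a : MonoidAlgebra K (Equiv.Perm ι)) :
    tensorRightMul K V (r • a) = r • tensorRightMul K V a := by
  simp only [tensorRightMul, MonoidAlgebra.coeff_smul]
  rw [Finsupp.sum_smul_index' (by simp), Finsupp.smul_sum]
  simp [mul_smul]

variable (K V) in
/-- The right action of the group algebra on the tensor power, as a linear map. -/
def tensorRightMulHom (ι : Type*) :
    MonoidAlgebra K (Equiv.Perm ι) →ₗ[K] (⨂[K] _ : ι, V) →ₗ[K] (⨂[K] _ : ι, V) where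
  toFun := tensorRightMul K V
  map_add' := tensorRightMul_add
  map_smul' := tensorRightMul_smul

theorem tensorRightMul_single {ι : Type*} (σ : Equiv.Perm ι) (x : K) :
    tensorRightMul K V (MonoidAlgebra.single σ x) =
      x • (PiTensorProduct.reindex K (fun _ : ι => V) σ⁻¹).toLinearMap := by
  simp [tensorRightMul, Finsupp.sum_single_index]

theorem tensorRightMul_single_tprod {ι : Type*} (σ : Equiv.Perm ι) (x : K) (v : ι → V) :
    tensorRightMul K V (MonoidAlgebra.single σ x) (PiTensorProduct.tprod K v) =
      x • PiTensorProduct.tprod K (v ∘ σ) := by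
  rw [tensorRightMul_single, LinearMap.smul_apply, LinearEquiv.coe_coe,
    PiTensorProduct.reindex_tprod]
  rfl

theorem tensorRightMul_mul {ι : Type*} (a b : MonoidAlgebra K (Equiv.Perm ι)) :
    tensorRightMul K V (a * b) = tensorRightMul K V b ∘ₗ tensorRightMul K V a := by
  induction a using MonoidAlgebra.induction_linear with
  | zero => simp [tensorRightMul]
  | add a a' h h' => simp [add_mul, tensorRightMul_add, h, h', LinearMap.comp_add]
  | single σ x =>
    induction b using MonoidAlgebra.induction_linear with
    | zero => simp [tensorRightMul]
    | add b b' h h' => simp [mul_add, tensorRightMul_add, h, h', LinearMap.add_comp]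
    | single τ y =>
      refine PiTensorProduct.ext (MultilinearMap.ext fun v => ?_)
      simp [MonoidAlgebra.single_mul_single, tensorRightMul_single_tprod, mul_smul,
        smul_comm x y, Function.comp_assoc]

theorem tensorRightMul_sum {ι α : Type*} (s : Finset α) (a : α → MonoidAlgebra K (Equiv.Perm ι)) :
    tensorRightMul K V (∑ i ∈ s, a i) = ∑ i ∈ s, tensorRightMul K V (a i) :=
  map_sum (tensorRightMulHom K V ι) _ _

theorem tensorRightMul_groupSum_tprod {ι : Type*} [Fintype ι] [DecidableEq ι]
    (w : Equiv.Perm ι → ℤ) (v : ι → V) :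
    tensorRightMul K V (groupSum K w) (PiTensorProduct.tprod K v) =
      ∑ τ, (w τ : K) • PiTensorProduct.tprod K (v ∘ τ) := by
  simp [groupSum, tensorRightMul_sum, tensorRightMul_single_tprod]

/-- Relabelling the tensor factors. -/
theorem tensorRightMul_reindex {ι κ : Type*} (e : ι ≃ κ) (a : MonoidAlgebra K (Equiv.Perm ι))
    (t : ⨂[K] _ : ι, V) :
    tensorRightMul K V (MonoidAlgebra.mapDomainAlgHom K K e.permCongrHom.toMonoidHom a)
        (PiTensorProduct.reindex K (fun _ => V) e t) =
      PiTensorProduct.reindex K (fun _ => V) e (tensorRightMul K V a t) := by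
  induction a using MonoidAlgebra.induction_linear with
  | zero => simp [tensorRightMul]
  | add a a' h h' => simp only [map_add, tensorRightMul_add, LinearMap.add_apply, h, h']
  | single σ x =>
    induction t using PiTensorProduct.induction_on with
    | smul_tprod r v =>
      simp only [map_smul, tensorRightMul_single_tprod]
      congr 1
      simp only [MonoidAlgebra.mapDomainAlgHom_apply, MonoidAlgebra.mapDomain_single]
      erw [PiTensorProduct.reindex_tprod, PiTensorProduct.reindex_tprod]
      rw [tensorRightMul_single_tprod]
      congr 2
      ext i
      exact congrArg v (e.symm_apply_apply _)
    | add t t' h h' => simp only [map_add, h, h']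

theorem tensorRep_reindex {ι κ : Type*} (e : ι ≃ κ) (g : LinearMap.GeneralLinearGroup K V)
    (t : ⨂[K] _ : ι, V) :
    PiTensorProduct.reindex K (fun _ => V) e (tensorRep K V ι g t) =
      tensorRep K V κ g (PiTensorProduct.reindex K (fun _ => V) e t) :=
  (PiTensorProduct.map_reindex (fun _ => (g : V →ₗ[K] V)) e t).symm

variable (K V) in
-- Numbering the cells by `Fin n` turns the Young symmetrizer into a function on `Perm (Fin n)`,
-- where identities can be decided by evaluation.
theorem schur_eq_map (μ : YoungDiagram) {n : ℕ} (e : Fin n ≃ μ.cells) (row col : Fin n → ℕ)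
    (he : ∀ i, (e i).1 = (row i, col i)) :
    (schur K V μ).toSubmodule =
      (LinearMap.range (tensorRightMul K V
        (groupSum K (fun σ => if ∀ i, row (σ i) = row i then 1 else 0) *
         groupSum K (fun σ => if ∀ i, col (σ i) = col i then (Equiv.Perm.sign σ : ℤ) else 0)))).map
        (PiTensorProduct.reindex K (fun _ => V) e).toLinearMap := by
  have key : youngSymmetrizer K μ = MonoidAlgebra.mapDomainAlgHom K K e.permCongrHom.toMonoidHom
      (groupSum K (fun σ => if ∀ i, row (σ i) = row i then 1 else 0) *
         groupSum K (fun σ => if ∀ i, col (σ i) = col i then (Equiv.Perm.sign σ : ℤ) else 0)) := by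
    rw [map_mul, youngSymmetrizer]
    congr 1
    · simp only [groupSum, map_sum, MonoidAlgebra.mapDomainAlgHom_apply,
        MonoidAlgebra.mapDomain_single, Finset.sum_filter]
      refine (Fintype.sum_equiv e.permCongr _ _ fun σ => ?_).symm
      have : (∀ c, ((e.permCongr σ) c).1.1 = c.1.1) ↔ ∀ i, row (σ i) = row i := by
        rw [← e.forall_congr_right]
        simp [he]
      by_cases h : ∀ i, row (σ i) = row i
      · rw [if_pos h, if_pos (this.2 h)]; simp
      · rw [if_neg h, if_neg (this.not.2 h)]; simp
    · simp only [groupSum, map_sum, MonoidAlgebra.mapDomainAlgHom_apply,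
        MonoidAlgebra.mapDomain_single, Finset.sum_filter]
      refine (Fintype.sum_equiv e.permCongr _ _ fun σ => ?_).symm
      have : (∀ c, ((e.permCongr σ) c).1.2 = c.1.2) ↔ ∀ i, col (σ i) = col i := by
        rw [← e.forall_congr_right]
        simp [he]
      by_cases h : ∀ i, col (σ i) = col i
      · rw [if_pos h, if_pos (this.2 h), Equiv.Perm.sign_permCongr]; rfl
      · rw [if_neg h, if_neg (this.not.2 h)]; simp
  ext x
  simp only [schur, key, Submodule.mem_map, LinearMap.mem_range]
  constructor
  · rintro ⟨t, rfl⟩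
    refine ⟨_, ⟨(PiTensorProduct.reindex K (fun _ => V) e).symm t, rfl⟩, ?_⟩
    rw [LinearEquiv.coe_coe, ← tensorRightMul_reindex, LinearEquiv.apply_symm_apply]
  · rintro ⟨_, ⟨t, rfl⟩, rfl⟩
    exact ⟨_, tensorRightMul_reindex e _ t⟩

end Tensor

/-! ### Identities in the integral group ring of `𝔖_4`. -/

section Square

/-- The row of each cell of the `2 × 2` square. -/
def squareRow : Fin 4 → Fin 3 := ![0, 0, 1, 1]

/-- The column of each cell of the `2 × 2` square. -/
def squareCol : Fin 4 → Fin 3 := ![0, 1, 0, 1]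

/-- The permutation of the cells of the `2 × 2` square exchanging the two cells of each row. -/
def squareSwap : Equiv.Perm (Fin 4) := Equiv.swap 0 1 * Equiv.swap 2 3

/-- The indicator function of the stabilizer of the partition of the square into its rows. -/
def dihedralWeight (τ : Equiv.Perm (Fin 4)) : ℤ :=
  if ∀ j, squareRow (τ⁻¹ (squareSwap j)) = squareRow (τ⁻¹ j) then 1 else 0

/-- The indicator function of the permutations preserving the rows of the square. -/
def rowWeight (τ : Equiv.Perm (Fin 4)) : ℤ :=
  if ∀ i, (squareRow (τ i) : ℕ) = squareRow i then 1 else 0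

/-- The sign, restricted to the permutations preserving the columns of the square. -/
def colWeight (τ : Equiv.Perm (Fin 4)) : ℤ :=
  if ∀ i, (squareCol (τ i) : ℕ) = squareCol i then (Equiv.Perm.sign τ : ℤ) else 0

/-- The dihedral group is the row group together with its coset by the exchange of the two rows.
That exchange is an even element of the column group, so it is absorbed by the signed column sum,
whence the factor 2. -/
theorem conv_dihedralWeight_colWeight :
    ∀ g, conv dihedralWeight colWeight g = 2 * conv rowWeight colWeight g := by
  decide +kernel

/-- The dihedral group has two double cosets in `𝔖_4`, so the product is a combination of `D` and
`S`. The coefficient at the identity is 16, since two elements of the column group, both even, are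
dihedral; the total of all coefficients is 0. This forces 24 and -8. -/
theorem conv_dihedralWeight_colWeight_dihedralWeight :
    ∀ g, conv (conv dihedralWeight colWeight) dihedralWeight g =
      24 * dihedralWeight g - 8 * 1 := by
  decide +kernel

theorem dihedralWeight_eq :
    ∀ τ, dihedralWeight τ = if τ * squareSwap = squareSwap * τ then 1 else 0 := by
  decide +kernel

theorem conv_one_colWeight : ∀ g, conv (fun _ => 1) colWeight g = 0 := by
  decide +kernel

theorem conv_colWeight_one : ∀ g, conv colWeight (fun _ => 1) g = 0 := by
  decide +kernel

theorem conv_dihedralWeight_one : ∀ g, conv dihedralWeight (fun _ => 1) g = 8 * 1 := by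
  decide +kernel

theorem conv_one_dihedralWeight : ∀ g, conv (fun _ => 1) dihedralWeight g = 8 * 1 := by
  decide +kernel

theorem conv_one_one : ∀ g : Equiv.Perm (Fin 4), conv (fun _ => 1) (fun _ => 1) g = 24 * 1 := by
  decide +kernel

theorem sum_dihedralWeight : ∑ g, dihedralWeight g = 8 := by
  decide +kernel

end Square

/-! ### Schur modules as images of explicit symmetrizers. -/

section Schur

variable {K : Type*} [Field K] {V : Type*} [AddCommGroup V] [Module K V]

variable (K V) in
/-- The right action on `V^{⊗ n}` of the element `∑ τ, w τ • τ` of the group algebra. -/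
def symmetrize {n : ℕ} (w : Equiv.Perm (Fin n) → ℤ) :
    (⨂[K] _ : Fin n, V) →ₗ[K] (⨂[K] _ : Fin n, V) :=
  tensorRightMul K V (groupSum K w)

theorem symmetrize_tprod {n : ℕ} (w : Equiv.Perm (Fin n) → ℤ) (v : Fin n → V) :
    symmetrize K V w (PiTensorProduct.tprod K v) =
      ∑ τ, (w τ : K) • PiTensorProduct.tprod K (v ∘ τ) :=
  tensorRightMul_groupSum_tprod w v

theorem symmetrize_symmetrize {n : ℕ} (w w' : Equiv.Perm (Fin n) → ℤ) (t : ⨂[K] _ : Fin n, V) :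
    symmetrize K V w' (symmetrize K V w t) = symmetrize K V (conv w w') t := by
  rw [symmetrize, symmetrize, symmetrize, ← groupSum_mul, tensorRightMul_mul]
  rfl

theorem symmetrize_linear {n : ℕ} {w w₁ w₂ : Equiv.Perm (Fin n) → ℤ} {a b : ℤ}
    (h : ∀ τ, w τ = a * w₁ τ - b * w₂ τ) :
    symmetrize K V w = (a : K) • symmetrize K V w₁ - (b : K) • symmetrize K V w₂ := by
  refine PiTensorProduct.ext (MultilinearMap.ext fun v => ?_)
  simp only [LinearMap.compMultilinearMap_apply, LinearMap.sub_apply, LinearMap.smul_apply,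
    symmetrize_tprod, h, Finset.smul_sum, ← Finset.sum_sub_distrib, smul_smul]
  push_cast
  simp only [sub_smul]

theorem symmetrize_mul_left {n : ℕ} {w w₁ : Equiv.Perm (Fin n) → ℤ} {a : ℤ}
    (h : ∀ τ, w τ = a * w₁ τ) : symmetrize K V w = (a : K) • symmetrize K V w₁ := by
  simpa using symmetrize_linear (K := K) (V := V) (w := w) (w₁ := w₁) (w₂ := w₁) (b := 0)
    fun τ => by simp [h]

theorem symmetrize_zero {n : ℕ} {w : Equiv.Perm (Fin n) → ℤ} (h : ∀ τ, w τ = 0) :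
    symmetrize K V w = 0 := by
  simpa using symmetrize_mul_left (K := K) (V := V) (w := w) (w₁ := w) (a := 0)
    fun τ => by simp [h]

theorem tensorRep_symmetrize {n : ℕ} (w : Equiv.Perm (Fin n) → ℤ)
    (g : LinearMap.GeneralLinearGroup K V) (t : ⨂[K] _ : Fin n, V) :
    symmetrize K V w (tensorRep K V _ g t) = tensorRep K V _ g (symmetrize K V w t) :=
  (tensorRep_tensorRightMul K V g _ t).symm

variable (K V) in
theorem schur_eq_map_symmetrize (μ : YoungDiagram) {n : ℕ} (e : Fin n ≃ μ.cells)
    (row col : Fin n → ℕ) (he : ∀ i, (e i).1 = (row i, col i)) (w : Equiv.Perm (Fin n) → ℤ)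
    (hw : ∀ g, conv (fun σ => if ∀ i, row (σ i) = row i then 1 else 0)
      (fun σ => if ∀ i, col (σ i) = col i then (Equiv.Perm.sign σ : ℤ) else 0) g = w g) :
    (schur K V μ).toSubmodule = (LinearMap.range (symmetrize K V w)).map
        (PiTensorProduct.reindex K (fun _ => V) e).toLinearMap := by
  rw [schur_eq_map K V μ e row col he, groupSum_mul, funext hw, symmetrize]

/-- The cells of a Young diagram, from a list of coordinates. -/
theorem exists_cells_equiv (μ : YoungDiagram) {n : ℕ} (c : Fin n → ℕ × ℕ)
    (hc : Function.Injective c) (hμ : μ.cells = Finset.univ.image c) :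
    ∃ e : Fin n ≃ μ.cells, ∀ i, (e i).1 = c i := by
  have h : ∀ x, x ∈ μ.cells ↔ ∃ i, c i = x := by simp [hμ]
  refine ⟨Equiv.ofBijective (fun i => ⟨c i, (h _).2 ⟨i, rfl⟩⟩) ⟨fun i j hij => hc ?_, ?_⟩,
    fun i => rfl⟩
  · exact congrArg Subtype.val hij
  · rintro ⟨x, hx⟩
    obtain ⟨i, rfl⟩ := (h x).1 hx
    exact ⟨i, rfl⟩

variable (K V) in
-- For a single row the column group is trivial and the row group is everything; for a single column
-- the roles are exchanged and the sign appears.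
theorem schur_four : ∃ e : Fin 4 ≃ (YoungDiagram.ofRowLens [4] (by decide)).cells,
    (schur K V (YoungDiagram.ofRowLens [4] (by decide))).toSubmodule =
      (LinearMap.range (symmetrize K V fun _ => 1)).map
        (PiTensorProduct.reindex K (fun _ => V) e).toLinearMap := by
  obtain ⟨e, he⟩ := exists_cells_equiv (YoungDiagram.ofRowLens [4] (by decide))
    (fun i : Fin 4 => (0, (i : ℕ))) (by decide) (by decide +kernel)
  exact ⟨e, schur_eq_map_symmetrize K V _ e _ _ he _ (by decide +kernel)⟩

variable (K V) in
theorem schur_two_two : ∃ e : Fin 4 ≃ (YoungDiagram.ofRowLens [2, 2] (by decide)).cells,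
    (schur K V (YoungDiagram.ofRowLens [2, 2] (by decide))).toSubmodule =
      (LinearMap.range (symmetrize K V (conv rowWeight colWeight))).map
        (PiTensorProduct.reindex K (fun _ => V) e).toLinearMap := by
  obtain ⟨e, he⟩ := exists_cells_equiv (YoungDiagram.ofRowLens [2, 2] (by decide))
    (fun i : Fin 4 => ((squareRow i : ℕ), (squareCol i : ℕ))) (by decide) (by decide +kernel)
  exact ⟨e, schur_eq_map_symmetrize K V _ e _ _ he _ fun _ => rfl⟩

variable (K V) in
theorem schur_one_one_one : ∃ e : Fin 3 ≃ (YoungDiagram.ofRowLens [1, 1, 1] (by decide)).cells,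
    (schur K V (YoungDiagram.ofRowLens [1, 1, 1] (by decide))).toSubmodule =
      (LinearMap.range (symmetrize K V fun τ => (Equiv.Perm.sign τ : ℤ))).map
        (PiTensorProduct.reindex K (fun _ => V) e).toLinearMap := by
  obtain ⟨e, he⟩ := exists_cells_equiv (YoungDiagram.ofRowLens [1, 1, 1] (by decide))
    (fun i : Fin 3 => ((i : ℕ), 0)) (by decide) (by decide +kernel)
  exact ⟨e, schur_eq_map_symmetrize K V _ e _ _ he _ (by decide +kernel)⟩

variable (K V) in
theorem schur_two : ∃ e : Fin 2 ≃ (YoungDiagram.ofRowLens [2] (by decide)).cells,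
    (schur K V (YoungDiagram.ofRowLens [2] (by decide))).toSubmodule =
      (LinearMap.range (symmetrize K V fun _ => 1)).map
        (PiTensorProduct.reindex K (fun _ => V) e).toLinearMap := by
  obtain ⟨e, he⟩ := exists_cells_equiv (YoungDiagram.ofRowLens [2] (by decide))
    (fun i : Fin 2 => (0, (i : ℕ))) (by decide) (by decide +kernel)
  exact ⟨e, schur_eq_map_symmetrize K V _ e _ _ he _ (by decide +kernel)⟩

end Schur

/-! ### Isomorphisms of subrepresentations from equivariant maps. -/

section Equivalence

variable {K G W W' W₁ W₂ : Type*} [Field K] [Group G] [AddCommGroup W] [Module K W]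
  [AddCommGroup W'] [Module K W'] [AddCommGroup W₁] [Module K W₁] [AddCommGroup W₂] [Module K W₂]

theorem nonempty_equiv_of_bijective {ρ : Representation K G W} {ρ' : Representation K G W'}
    (F : W →ₗ[K] W') (hF : ∀ g x, F (ρ g x) = ρ' g (F x)) (hbij : Function.Bijective F) :
    Nonempty (ρ.Equiv ρ') :=
  ⟨.mk (LinearEquiv.ofBijective F hbij) fun g => LinearMap.ext fun x => hF g x⟩

theorem nonempty_equiv_of_map_eq {ρ : Representation K G W} {ρ' : Representation K G W'}
    (σ : Subrepresentation ρ) (σ' : Subrepresentation ρ') (F : W →ₗ[K] W')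
    (hF : ∀ g x, F (ρ g x) = ρ' g (F x)) (hmap : σ.toSubmodule.map F = σ'.toSubmodule)
    (hinj : ∀ x ∈ σ.toSubmodule, F x = 0 → x = 0) :
    Nonempty (σ.toRepresentation.Equiv σ'.toRepresentation) := by
  have hmem : ∀ x ∈ σ.toSubmodule, F x ∈ σ'.toSubmodule := fun x hx =>
    hmap ▸ Submodule.mem_map_of_mem hx
  refine nonempty_equiv_of_bijective (F.restrict hmem) (fun g x => Subtype.ext (hF g x)) ⟨?_, ?_⟩
  · refine (injective_iff_map_eq_zero _).2 fun x hx => Subtype.ext (hinj x x.2 ?_)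
    exact congrArg Subtype.val hx
  · rintro ⟨y, hy⟩
    rw [← hmap] at hy
    obtain ⟨x, hx, rfl⟩ := hy
    exact ⟨⟨x, hx⟩, rfl⟩

theorem nonempty_equiv_prod {ρ : Representation K G W} {ρ₁ : Representation K G W₁}
    {ρ₂ : Representation K G W₂}
    (σ : Subrepresentation ρ) (σ₁ : Subrepresentation ρ₁) (σ₂ : Subrepresentation ρ₂)
    (F₁ : W →ₗ[K] W₁) (F₂ : W →ₗ[K] W₂)
    (hF₁ : ∀ g x, F₁ (ρ g x) = ρ₁ g (F₁ x)) (hF₂ : ∀ g x, F₂ (ρ g x) = ρ₂ g (F₂ x))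
    (hmem₁ : ∀ x ∈ σ.toSubmodule, F₁ x ∈ σ₁.toSubmodule)
    (hmem₂ : ∀ x ∈ σ.toSubmodule, F₂ x ∈ σ₂.toSubmodule)
    (hinj : ∀ x ∈ σ.toSubmodule, F₁ x = 0 → F₂ x = 0 → x = 0)
    (hsurj : ∀ y₁ ∈ σ₁.toSubmodule, ∀ y₂ ∈ σ₂.toSubmodule,
      ∃ x ∈ σ.toSubmodule, F₁ x = y₁ ∧ F₂ x = y₂) :
    Nonempty (σ.toRepresentation.Equiv (σ₁.toRepresentation.prod σ₂.toRepresentation)) := by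
  refine nonempty_equiv_of_bijective ((F₁.restrict hmem₁).prod (F₂.restrict hmem₂))
    (fun g x => Prod.ext (Subtype.ext (hF₁ g x)) (Subtype.ext (hF₂ g x))) ⟨?_, ?_⟩
  · refine (injective_iff_map_eq_zero _).2 fun x hx => Subtype.ext (hinj x x.2 ?_ ?_)
    · exact congrArg (fun y => (y.1 : W₁)) hx
    · exact congrArg (fun y => (y.2 : W₂)) hx
  · rintro ⟨⟨y₁, h₁⟩, ⟨y₂, h₂⟩⟩
    obtain ⟨x, hx, rfl, rfl⟩ := hsurj y₁ h₁ y₂ h₂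
    exact ⟨⟨x, hx⟩, rfl⟩

end Equivalence

/-! ### Recognizing Schur modules from the maps `f` and `g`. -/

section Recognition

variable {K V W : Type*} [Field K] [AddCommGroup V] [Module K V] [AddCommGroup W] [Module K W]
  {ρ : Representation K (LinearMap.GeneralLinearGroup K V) W}

/-- The relation `f ∘ g ∘ f = c • f` makes `g` injective on the range of `f`, and `g ∘ f` computes
its image. -/
theorem nonempty_equiv_schur {n : ℕ} (σ : Subrepresentation ρ) (μ : YoungDiagram)
    (e : Fin n ≃ μ.cells) (w : Equiv.Perm (Fin n) → ℤ)
    (hμ : (schur K V μ).toSubmodule = (LinearMap.range (symmetrize K V w)).map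
        (PiTensorProduct.reindex K (fun _ => V) e).toLinearMap)
    (f : (⨂[K] _ : Fin n, V) →ₗ[K] W) (g : W →ₗ[K] ⨂[K] _ : Fin n, V)
    (hσ : σ.toSubmodule = LinearMap.range f)
    (hg : ∀ a x, g (ρ a x) = tensorRep K V _ a (g x))
    {c r : K} (hc : c ≠ 0) (hr : r ≠ 0) (hfg : ∀ t, f (g (f t)) = c • f t)
    (hgf : ∀ t, g (f t) = r • symmetrize K V w t) :
    Nonempty (σ.toRepresentation.Equiv (schur K V μ).toRepresentation) := by
  refine nonempty_equiv_of_map_eq σ _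
    ((PiTensorProduct.reindex K (fun _ => V) e).toLinearMap ∘ₗ g) (fun a x => ?_) ?_ ?_
  · rw [LinearMap.comp_apply, hg]
    exact tensorRep_reindex e a (g x)
  · rw [hσ, hμ, Submodule.map_comp, ← LinearMap.range_comp]
    have : g ∘ₗ f = r • symmetrize K V w := LinearMap.ext hgf
    rw [this, LinearMap.range_smul _ _ hr]
  · rw [hσ]
    rintro _ ⟨t, rfl⟩ h
    have h' : g (f t) = 0 :=
      (PiTensorProduct.reindex K (fun _ => V) e).map_eq_zero_iff.1 h
    have := hfg t
    rw [h', map_zero] at this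
    exact (smul_eq_zero.1 this.symm).resolve_left hc

/-- The two components are obtained by multiplying `g x` by `S` and by `C`. The auxiliary identities
are written for the right action, so the innermost symmetrizer is the leftmost factor. -/
theorem nonempty_equiv_schur_prod [CharZero K] (σ : Subrepresentation ρ)
    (f : (⨂[K] _ : Fin 4, V) →ₗ[K] W) (g : W →ₗ[K] ⨂[K] _ : Fin 4, V)
    (hσ : σ.toSubmodule = LinearMap.range f)
    (hg : ∀ a x, g (ρ a x) = tensorRep K V _ a (g x))
    {c : K} (hc : c ≠ 0) (hfg : ∀ t, f (g (f t)) = c • f t)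
    (hgf : ∀ t, g (f t) = symmetrize K V dihedralWeight t) :
    Nonempty (σ.toRepresentation.Equiv
      ((schurRep K V [4] (by decide)).prod (schurRep K V [2, 2] (by decide)))) := by
  obtain ⟨e₁, h₁⟩ := schur_four K V
  obtain ⟨e₂, h₂⟩ := schur_two_two K V
  have dbd (t : ⨂[K] _ : Fin 4, V) : symmetrize K V dihedralWeight (symmetrize K V colWeight
      (symmetrize K V dihedralWeight t)) =
      (24 : K) • symmetrize K V dihedralWeight t - (8 : K) • symmetrize K V (fun _ => 1) t := by
    rw [symmetrize_symmetrize dihedralWeight, symmetrize_symmetrize,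
      symmetrize_linear conv_dihedralWeight_colWeight_dihedralWeight]
    simp
  have db (t : ⨂[K] _ : Fin 4, V) : symmetrize K V colWeight (symmetrize K V dihedralWeight t) =
      (2 : K) • symmetrize K V (conv rowWeight colWeight) t := by
    rw [symmetrize_symmetrize, symmetrize_mul_left conv_dihedralWeight_colWeight]
    simp
  have sb (t : ⨂[K] _ : Fin 4, V) :
      symmetrize K V colWeight (symmetrize K V (fun _ => 1) t) = 0 := by
    rw [symmetrize_symmetrize, symmetrize_zero conv_one_colWeight, LinearMap.zero_apply]
  have bs (t : ⨂[K] _ : Fin 4, V) :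
      symmetrize K V (fun _ => 1) (symmetrize K V colWeight t) = 0 := by
    rw [symmetrize_symmetrize, symmetrize_zero conv_colWeight_one, LinearMap.zero_apply]
  have ds (t : ⨂[K] _ : Fin 4, V) : symmetrize K V (fun _ => 1) (symmetrize K V dihedralWeight t) =
      (8 : K) • symmetrize K V (fun _ => 1) t := by
    rw [symmetrize_symmetrize, symmetrize_mul_left conv_dihedralWeight_one]
    simp
  have sd (t : ⨂[K] _ : Fin 4, V) : symmetrize K V dihedralWeight (symmetrize K V (fun _ => 1) t) =
      (8 : K) • symmetrize K V (fun _ => 1) t := by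
    rw [symmetrize_symmetrize, symmetrize_mul_left conv_one_dihedralWeight]
    simp
  have ss (t : ⨂[K] _ : Fin 4, V) : symmetrize K V (fun _ => 1) (symmetrize K V (fun _ => 1) t) =
      (24 : K) • symmetrize K V (fun _ => 1) t := by
    rw [symmetrize_symmetrize, symmetrize_mul_left conv_one_one]
    simp
  refine nonempty_equiv_prod σ _ _
    ((PiTensorProduct.reindex K (fun _ => V) e₁).toLinearMap ∘ₗ symmetrize K V (fun _ => 1) ∘ₗ g)
    ((PiTensorProduct.reindex K (fun _ => V) e₂).toLinearMap ∘ₗ symmetrize K V colWeight ∘ₗ g)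
    (fun a x => ?_) (fun a x => ?_) (fun x hx => ?_) (fun x hx => ?_) (fun x hx hx₁ hx₂ => ?_)
    (fun y₁ hy₁ y₂ hy₂ => ?_)
  · rw [LinearMap.comp_apply, LinearMap.comp_apply, hg, tensorRep_symmetrize]
    exact tensorRep_reindex e₁ a _
  · rw [LinearMap.comp_apply, LinearMap.comp_apply, hg, tensorRep_symmetrize]
    exact tensorRep_reindex e₂ a _
  · rw [h₁]
    exact Submodule.mem_map_of_mem ⟨g x, rfl⟩
  · rw [hσ] at hx
    obtain ⟨t, rfl⟩ := hx
    rw [h₂, LinearMap.comp_apply, LinearMap.comp_apply, hgf, db]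
    exact Submodule.mem_map_of_mem (Submodule.smul_mem _ _ ⟨t, rfl⟩)
  · rw [hσ] at hx
    obtain ⟨t, rfl⟩ := hx
    have e1 : symmetrize K V (fun _ => 1) (g (f t)) = 0 :=
      (PiTensorProduct.reindex K (fun _ => V) e₁).map_eq_zero_iff.1 hx₁
    have e2 : symmetrize K V colWeight (g (f t)) = 0 :=
      (PiTensorProduct.reindex K (fun _ => V) e₂).map_eq_zero_iff.1 hx₂
    rw [hgf] at e1 e2
    -- Since `8 t S = t D S`, this reads `t D C D = 24 t D - t D S`, and the terms containing `t D
    -- C` and `t D S` vanish.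
    have e3 := dbd t
    rw [e2, map_zero, ← ds, e1, sub_zero, ← hgf] at e3
    have e4 : g (f t) = 0 := (smul_eq_zero.1 e3.symm).resolve_left (by norm_num)
    have := hfg t
    rw [e4, map_zero] at this
    exact (smul_eq_zero.1 this.symm).resolve_left hc
  · rw [h₁] at hy₁
    rw [h₂] at hy₂
    obtain ⟨_, ⟨s, rfl⟩, rfl⟩ := hy₁
    obtain ⟨_, ⟨t, rfl⟩, rfl⟩ := hy₂
    -- The two summands do not interfere because `S C = C S = 0`. The constants invert `S D S = 8 ·
    -- 24 S` and `D C D C = 24 D C = 24 · 2 R C`.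
    let z := (24 * 8 : K)⁻¹ • symmetrize K V (fun _ => 1) s +
      (2 * 24 : K)⁻¹ • symmetrize K V colWeight (symmetrize K V dihedralWeight t)
    have z₁ : symmetrize K V (fun _ => 1) (g (f z)) = symmetrize K V (fun _ => 1) s := by
      simp only [z]
      rw [hgf, ds, map_add, map_smul, map_smul, bs, ss, smul_zero, add_zero, smul_smul, smul_smul]
      norm_num
    have z₂ : symmetrize K V colWeight (g (f z)) =
        symmetrize K V (conv rowWeight colWeight) t := by
      simp only [z]
      rw [hgf, map_add, map_smul, map_smul, dbd, sd, map_add, map_smul, map_smul, map_smul,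
        map_sub, map_smul, map_smul, sb, smul_zero, smul_zero, zero_add, sb, smul_zero, sub_zero, db,
        smul_smul, smul_smul]
      norm_num
    exact ⟨f z, hσ ▸ ⟨_, rfl⟩, congrArg (PiTensorProduct.reindex K (fun _ => V) e₁) z₁,
      congrArg (PiTensorProduct.reindex K (fun _ => V) e₂) z₂⟩

end Recognition

/-! ### The `so(3)` weight system and its invariance. -/

section WeightSystem

/-- The structure constants of `so(3)`: the sign of `(a, b, c)` as a permutation of `(0, 1, 2)`. -/
def leviCivita (a b c : Fin 3) : ℤ :=
  if b = a + 1 ∧ c = a + 2 then 1 else if b = a + 2 ∧ c = a + 1 then -1 else 0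

theorem leviCivita_rotate (r : Fin 3) (x : Fin 3 → Fin 3) :
    leviCivita (x (r + 0)) (x (r + 1)) (x (r + 2)) = leviCivita (x 0) (x 1) (x 2) := by
  have h : ∀ r a b c : Fin 3, leviCivita (![a, b, c] (r + 0)) (![a, b, c] (r + 1))
      (![a, b, c] (r + 2)) = leviCivita a b c := by decide
  have hx : x = ![x 0, x 1, x 2] := by ext i; fin_cases i <;> rfl
  rw [hx]
  exact h r _ _ _

theorem leviCivita_swap : ∀ a b c, leviCivita a c b = -leviCivita a b c := by decide

/-- The Jacobi identity of `so(3)`, with `x` the label of the inner edge. The sum over that label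
starts at an arbitrary `x`, to match the shifts of a given labelling. -/
theorem leviCivita_jacobi : ∀ a b c r x : Fin 3,
    (leviCivita x a b * leviCivita x c r +
      leviCivita (x + 1) a b * leviCivita (x + 1) c r +
      leviCivita (x + 2) a b * leviCivita (x + 2) c r) +
    (leviCivita x c a * leviCivita x b r +
      leviCivita (x + 1) c a * leviCivita (x + 1) b r +
      leviCivita (x + 2) c a * leviCivita (x + 2) b r) +
    (leviCivita x b c * leviCivita x a r +
      leviCivita (x + 1) b c * leviCivita (x + 1) a r +
      leviCivita (x + 2) b c * leviCivita (x + 2) a r) = 0 := by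
  decide +kernel

variable {n m k : ℕ}

/-- The product over the trivalent vertices of the structure constants of the labels. -/
def labelWeight (l : HalfEdge m k → Fin 3) : ℤ :=
  ∏ w, leviCivita (l (slot w 0)) (l (slot w 1)) (l (slot w 2))

/-- The labellings of the edges by `Fin 3` which are given by `φ` at the univalent vertices. -/
def IsLabelling (φ : Fin n → Fin 3) (e : Equiv.Perm (HalfEdge m k)) (τ : Fin n ≃ Fin m)
    (l : HalfEdge m k → Fin 3) : Prop :=
  (∀ h, l (e h) = l h) ∧ ∀ i, l (Sum.inl (τ i)) = φ i

instance (φ : Fin n → Fin 3) (e : Equiv.Perm (HalfEdge m k)) (τ : Fin n ≃ Fin m) :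
    DecidablePred (IsLabelling φ e τ) := fun _ => instDecidableAnd

/-- The `so(3)` weight system with prescribed labels at the univalent vertices. -/
def graphWeight (φ : Fin n → Fin 3) (e : Equiv.Perm (HalfEdge m k)) (τ : Fin n ≃ Fin m) : ℤ :=
  ∑ l with IsLabelling φ e τ l, labelWeight l

theorem isLabelling_conj (φ : Fin n → Fin 3) (e ρ : Equiv.Perm (HalfEdge m k)) (τ : Fin n ≃ Fin m)
    (α : Equiv.Perm (Fin m)) (hα : ∀ u, ρ (Sum.inl u) = Sum.inl (α u)) (l : HalfEdge m k → Fin 3) :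
    IsLabelling φ e τ (l ∘ ρ) ↔ IsLabelling φ (ρ * e * ρ⁻¹) (τ.trans α) l := by
  refine and_congr ?_ ?_
  · rw [← ρ.forall_congr_right (q := fun h => l ((ρ * e * ρ⁻¹) h) = l h)]
    simp
  · simp [hα]

/-- The substitution `l ↦ l ∘ ρ` moves a change of the graph to a change of the integrand;
invariance under isomorphisms, AS and IHX then becomes a statement about `labelWeight`. -/
theorem graphWeight_eq_sum_conj (φ : Fin n → Fin 3) (e ρ : Equiv.Perm (HalfEdge m k))
    (τ : Fin n ≃ Fin m) (α : Equiv.Perm (Fin m)) (hα : ∀ u, ρ (Sum.inl u) = Sum.inl (α u)) :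
    graphWeight φ e τ =
      ∑ l with IsLabelling φ (ρ * e * ρ⁻¹) (τ.trans α) l, labelWeight (l ∘ ρ) := by
  simp only [graphWeight, Finset.sum_filter]
  refine (Fintype.sum_equiv (ρ.symm.arrowCongr (Equiv.refl (Fin 3))) _ _ fun l => ?_).symm
  have : (ρ.symm.arrowCongr (Equiv.refl (Fin 3))) l = l ∘ ρ := rfl
  simp only [this, isLabelling_conj φ e ρ τ α hα]

/-- A vertex-compatible bijection of the half-edges at trivalent vertices respecting the cyclic
orders is given by a permutation of the vertices and a rotation at each vertex. -/
theorem exists_perm_of_rotate (β : Equiv.Perm (Fin k × Fin 3))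
    (hβ : ∀ w i, β (w, i + 1) = ((β (w, i)).1, (β (w, i)).2 + 1)) :
    ∃ (π : Equiv.Perm (Fin k)) (r : Fin k → Fin 3), ∀ w i, β (w, i) = (π w, r w + i) := by
  have h (w : Fin k) (i : Fin 3) : β (w, i) = ((β (w, 0)).1, (β (w, 0)).2 + i) := by
    have h₁ := hβ w 0
    have h₂ := hβ w 1
    fin_cases i
    · simp
    · exact h₁
    · rw [zero_add] at h₁
      rw [h₁] at h₂
      refine h₂.trans (Prod.ext rfl ?_)
      simp only [add_assoc]
      rfl
  have hs : Function.Surjective fun w => (β (w, 0)).1 := fun w => by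
    obtain ⟨⟨w', i⟩, hw⟩ := β.surjective (w, 0)
    exact ⟨w', by simpa [hw] using (congrArg Prod.fst (h w' i)).symm⟩
  exact ⟨Equiv.ofBijective _ ⟨Finite.injective_iff_surjective.2 hs, hs⟩, fun w => (β (w, 0)).2, h⟩

theorem labelWeight_comp_iso (α : Equiv.Perm (Fin m)) (β : Equiv.Perm (Fin k × Fin 3))
    (hβ : ∀ w i, β (w, i + 1) = ((β (w, i)).1, (β (w, i)).2 + 1)) (l : HalfEdge m k → Fin 3) :
    labelWeight (l ∘ Equiv.sumCongr α β) = labelWeight l := by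
  obtain ⟨π, r, h⟩ := exists_perm_of_rotate β hβ
  have : ∀ w, leviCivita ((l ∘ Equiv.sumCongr α β) (slot w 0)) ((l ∘ Equiv.sumCongr α β) (slot w 1))
      ((l ∘ Equiv.sumCongr α β) (slot w 2)) =
      leviCivita (l (slot (π w) 0)) (l (slot (π w) 1)) (l (slot (π w) 2)) := fun w => by
    simpa [slot, h] using leviCivita_rotate (r w) fun i => l (slot (π w) i)
  simp only [labelWeight, this]
  exact Equiv.prod_comp π fun w => leviCivita (l (slot w 0)) (l (slot w 1)) (l (slot w 2))

theorem slot_ne_slot {w w' : Fin k} (h : w ≠ w') (i j : Fin 3) :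
    (slot w i : HalfEdge m k) ≠ slot w' j := by
  simp [slot, h]

theorem labelWeight_comp_flip (w : Fin k) (l : HalfEdge m k → Fin 3) :
    labelWeight (l ∘ flip w) = -labelWeight l := by
  rw [labelWeight, labelWeight, ← Finset.mul_prod_erase _ _ (Finset.mem_univ w),
    ← Finset.mul_prod_erase (Finset.univ : Finset (Fin k)) _ (Finset.mem_univ w), ← neg_mul]
  congr 1
  · rw [← leviCivita_swap]
    simp [OpenJacobiDiagram.flip, slot, Equiv.swap_apply_def]
  · refine Finset.prod_congr rfl fun w' hw' => ?_
    have h := Finset.ne_of_mem_erase hw'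
    simp [OpenJacobiDiagram.flip, slot, Equiv.swap_apply_def, h]

theorem labelWeight_eq_mul (w w' : Fin k) (hw : w ≠ w') (l : HalfEdge m k → Fin 3) :
    labelWeight l = leviCivita (l (slot w 0)) (l (slot w 1)) (l (slot w 2)) *
      leviCivita (l (slot w' 0)) (l (slot w' 1)) (l (slot w' 2)) *
      ∏ v ∈ (Finset.univ.erase w).erase w',
        leviCivita (l (slot v 0)) (l (slot v 1)) (l (slot v 2)) := by
  rw [labelWeight, ← Finset.mul_prod_erase _ _ (Finset.mem_univ w), mul_assoc,
    Finset.mul_prod_erase _ (fun v => leviCivita (l (slot v 0)) (l (slot v 1)) (l (slot v 2)))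
      (Finset.mem_erase.2 ⟨hw.symm, Finset.mem_univ w'⟩)]

theorem rotate_apply (w w' : Fin k) (hw : w ≠ w') :
    (rotate (m := m) w w') (slot w 1) = slot w 2 ∧ (rotate (m := m) w w') (slot w 2) = slot w' 1 ∧
    (rotate (m := m) w w') (slot w' 1) = slot w 1 ∧
    ∀ h, h ≠ slot w 1 → h ≠ slot w 2 → h ≠ slot w' 1 → (rotate (m := m) w w') h = h := by
  have h' := hw.symm
  refine ⟨?_, ?_, ?_, fun h h₁ h₂ h₃ => ?_⟩
  · simp [rotate, slot, Equiv.swap_apply_def, hw]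
  · simp [rotate, slot, Equiv.swap_apply_def, h']
  · simp [rotate, slot]
  · simp [rotate, Equiv.swap_apply_of_ne_of_ne h₂ h₃, Equiv.swap_apply_of_ne_of_ne h₁ h₂]

/-- Shift the label of the edge joining `(w, 0)` and `(w', 0)`. -/
def shiftLabel (w w' : Fin k) (s : Fin 3) : Equiv.Perm (HalfEdge m k → Fin 3) where
  toFun l h := if h = slot w 0 ∨ h = slot w' 0 then l h + s else l h
  invFun l h := if h = slot w 0 ∨ h = slot w' 0 then l h - s else l h
  left_inv l := by ext h; by_cases hh : h = slot w 0 ∨ h = slot w' 0 <;> simp [hh]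
  right_inv l := by ext h; by_cases hh : h = slot w 0 ∨ h = slot w' 0 <;> simp [hh]

theorem isLabelling_shiftLabel (φ : Fin n → Fin 3) (e : Equiv.Perm (HalfEdge m k))
    (hinv : ∀ h, e (e h) = h) (τ : Fin n ≃ Fin m) (w w' : Fin k) (he : e (slot w 0) = slot w' 0)
    (s : Fin 3) (l : HalfEdge m k → Fin 3) :
    IsLabelling φ e τ (shiftLabel w w' s l) ↔ IsLabelling φ e τ l := by
  refine and_congr (forall_congr' fun h => ?_) (forall_congr' fun i => ?_)
  · have he' : e (slot w' 0) = slot w 0 := by rw [← he, hinv]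
    have : (e h = slot w 0 ∨ e h = slot w' 0) ↔ (h = slot w 0 ∨ h = slot w' 0) := by
      rw [← he, e.injective.eq_iff, he, ← he', e.injective.eq_iff, or_comm]
    by_cases hh : h = slot w 0 ∨ h = slot w' 0
    · simp only [shiftLabel, Equiv.coe_fn_mk, if_pos (this.2 hh), if_pos hh, add_left_inj]
    · simp only [shiftLabel, Equiv.coe_fn_mk, if_neg (this.not.2 hh), if_neg hh]
  · simp [shiftLabel, slot]

/-- The sum of the weights of the three labellings of an IHX relation. -/
def ihxWeight (w w' : Fin k) (l : HalfEdge m k → Fin 3) : ℤ :=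
  labelWeight l + labelWeight (l ∘ ((rotate w w')⁻¹ : Equiv.Perm (HalfEdge m k))) +
    labelWeight (l ∘ ((rotate w w')⁻¹ * (rotate w w')⁻¹ : Equiv.Perm (HalfEdge m k)))

/-- The three terms differ only in the labels around `w` and `w'`, so the contribution of the other
vertices factors out and the Jacobi summand for one inner label remains. -/
theorem ihxWeight_shiftLabel (w w' : Fin k) (hw : w ≠ w') (l : HalfEdge m k → Fin 3)
    (hl : l (slot w' 0) = l (slot w 0)) (s : Fin 3) :
    ihxWeight w w' (shiftLabel w w' s l) =
      (leviCivita (l (slot w 0) + s) (l (slot w 1)) (l (slot w 2)) *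
        leviCivita (l (slot w 0) + s) (l (slot w' 1)) (l (slot w' 2)) +
      leviCivita (l (slot w 0) + s) (l (slot w' 1)) (l (slot w 1)) *
        leviCivita (l (slot w 0) + s) (l (slot w 2)) (l (slot w' 2)) +
      leviCivita (l (slot w 0) + s) (l (slot w 2)) (l (slot w' 1)) *
        leviCivita (l (slot w 0) + s) (l (slot w 1)) (l (slot w' 2))) *
      ∏ v ∈ (Finset.univ.erase w).erase w',
        leviCivita (l (slot v 0)) (l (slot v 1)) (l (slot v 2)) := by
  have hw' := hw.symm
  obtain ⟨r₁, r₂, r₃, r₄⟩ := rotate_apply (m := m) w w' hw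
  have q₁ : (rotate (m := m) w w')⁻¹ (slot w 1) = slot w' 1 := by rw [Equiv.Perm.inv_eq_iff_eq, r₃]
  have q₂ : (rotate (m := m) w w')⁻¹ (slot w 2) = slot w 1 := by rw [Equiv.Perm.inv_eq_iff_eq, r₁]
  have q₃ : (rotate (m := m) w w')⁻¹ (slot w' 1) = slot w 2 := by rw [Equiv.Perm.inv_eq_iff_eq, r₂]
  have q₄ : ∀ v i, (v = w → i = 0) → (v = w' → i ≠ 1) →
      (rotate (m := m) w w')⁻¹ (slot v i) = slot v i := fun v i h₁ h₂ => by
    rw [Equiv.Perm.inv_eq_iff_eq, r₄]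
    · rintro ⟨⟩; simp at h₁
    · rintro ⟨⟩; simp at h₁
    · rintro ⟨⟩; simp at h₂
  have q₅ := q₄ w 0 (by simp) (by simp)
  have q₆ := q₄ w' 0 (by simp) (by simp)
  have q₇ := q₄ w' 2 (by simp [hw']) (by simp)
  have q₈ : ∀ v ∈ (Finset.univ.erase w).erase w', ∀ i,
      (rotate (m := m) w w')⁻¹ (slot v i) = slot v i := fun v hv i => by
    simp only [Finset.mem_erase] at hv
    exact q₄ v i (fun h => absurd h hv.2.1) fun h => absurd h hv.1
  have sh : ∀ v i, i ≠ 0 → shiftLabel w w' s l (slot v i) = l (slot v i) := fun v i hi => by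
    simp [shiftLabel, slot, hi]
  have sh₁ : shiftLabel w w' s l (slot w 0) = l (slot w 0) + s := by simp [shiftLabel]
  have sh₂ : shiftLabel w w' s l (slot w' 0) = l (slot w 0) + s := by simp [shiftLabel, hl]
  have sh₃ : ∀ v ∈ (Finset.univ.erase w).erase w', ∀ i,
      shiftLabel w w' s l (slot v i) = l (slot v i) := fun v hv i => by
    simp only [Finset.mem_erase] at hv
    simp [shiftLabel, slot, hv.1, hv.2.1]
  rw [ihxWeight, labelWeight_eq_mul w w' hw, labelWeight_eq_mul w w' hw,
    labelWeight_eq_mul w w' hw, add_mul, add_mul]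
  simp only [Function.comp_apply, Equiv.Perm.mul_apply, q₁, q₂, q₃, q₅, q₆, q₇, sh₁, sh₂,
    sh _ 1 (by decide), sh _ 2 (by decide)]
  refine congrArg₂ _ (congrArg₂ _ ?_ ?_) ?_ <;>
    refine congrArg₂ (· * ·) rfl (Finset.prod_congr rfl fun v hv => ?_) <;>
    simp only [q₈ v hv, sh₃ v hv]

/-- Shifting the label of the inner edge permutes the labellings. Adding the sums for the three
shifts thus triples the sum, while Jacobi makes the combined summand vanish for every labelling. -/
theorem sum_ihxWeight (φ : Fin n → Fin 3) (e : Equiv.Perm (HalfEdge m k))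
    (hinv : ∀ h, e (e h) = h) (τ : Fin n ≃ Fin m) (w w' : Fin k) (hw : w ≠ w')
    (he : e (slot w 0) = slot w' 0) :
    ∑ l with IsLabelling φ e τ l, ihxWeight w w' l = 0 := by
  have h (s : Fin 3) : ∑ l with IsLabelling φ e τ l, ihxWeight w w' (shiftLabel w w' s l) =
      ∑ l with IsLabelling φ e τ l, ihxWeight w w' l := by
    simp only [Finset.sum_filter]
    refine Fintype.sum_equiv (shiftLabel w w' s) _ _ fun l => ?_
    simp only [isLabelling_shiftLabel φ e hinv τ w w' he]
  have h₀ : ∑ l with IsLabelling φ e τ l, (ihxWeight w w' (shiftLabel w w' 0 l) +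
      ihxWeight w w' (shiftLabel w w' 1 l) + ihxWeight w w' (shiftLabel w w' 2 l)) = 0 := by
    refine Finset.sum_eq_zero fun l hl => ?_
    have hl : l (slot w' 0) = l (slot w 0) := by
      rw [← he]
      exact (Finset.mem_filter.1 hl).2.1 _
    simp only [ihxWeight_shiftLabel w w' hw l hl, ← add_mul]
    refine mul_eq_zero_of_left ?_ _
    rw [← leviCivita_jacobi (l (slot w 1)) (l (slot w 2)) (l (slot w' 1)) (l (slot w' 2))
      (l (slot w 0))]
    rw [add_zero]
    ring
  rw [Finset.sum_add_distrib, Finset.sum_add_distrib, h, h, h] at h₀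
  linarith

/-- All three graphs are conjugate under powers of `rotate`, so their labellings are pulled back to
labellings of the first one. -/
theorem graphWeight_ihx (φ : Fin n → Fin 3) (e : Equiv.Perm (HalfEdge m k))
    (hinv : ∀ h, e (e h) = h) (τ : Fin n ≃ Fin m) (w w' : Fin k) (hw : w ≠ w')
    (he : e (slot w 0) = slot w' 0) {ρ : Equiv.Perm (HalfEdge m k)} (hρ : ρ = rotate w w') :
    graphWeight φ e τ + graphWeight φ (ρ * e * ρ⁻¹) τ +
      graphWeight φ (ρ * (ρ * e * ρ⁻¹) * ρ⁻¹) τ = 0 := by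
  have h₁ : ∀ u, ρ⁻¹ (Sum.inl u) = Sum.inl u := fun u => by
    rw [Equiv.Perm.inv_eq_iff_eq, hρ, (rotate_apply w w' hw).2.2.2] <;> simp [slot]
  rw [graphWeight_eq_sum_conj φ (ρ * e * ρ⁻¹) ρ⁻¹ τ 1 h₁,
    graphWeight_eq_sum_conj φ (ρ * (ρ * e * ρ⁻¹) * ρ⁻¹) (ρ⁻¹ * ρ⁻¹) τ 1 fun u => by
      rw [Equiv.Perm.mul_apply, h₁, h₁]; rfl]
  have e₁ : ρ⁻¹ * (ρ * e * ρ⁻¹) * ρ⁻¹⁻¹ = e := by group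
  have e₂ : ρ⁻¹ * ρ⁻¹ * (ρ * (ρ * e * ρ⁻¹) * ρ⁻¹) * (ρ⁻¹ * ρ⁻¹)⁻¹ = e := by group
  have e₃ : τ.trans (1 : Equiv.Perm (Fin m)) = τ := rfl
  rw [e₁, e₂, e₃, graphWeight, ← Finset.sum_add_distrib, ← Finset.sum_add_distrib, hρ]
  exact sum_ihxWeight φ e hinv τ w w' hw he

theorem graphWeight_flip (φ : Fin n → Fin 3) (e : Equiv.Perm (HalfEdge m k)) (τ : Fin n ≃ Fin m)
    (w : Fin k) : graphWeight φ (flip w * e * (flip w)⁻¹) τ = -graphWeight φ e τ := by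
  rw [graphWeight_eq_sum_conj φ e (flip w) τ 1 fun u => by
      simp [OpenJacobiDiagram.flip, Equiv.swap_apply_of_ne_of_ne],
    ← Finset.sum_neg_distrib]
  simp only [labelWeight_comp_flip, neg_neg]
  rfl

theorem graphWeight_iso (φ : Fin n → Fin 3) (e e' : Equiv.Perm (HalfEdge m k))
    (τ : Fin n ≃ Fin m) (α : Equiv.Perm (Fin m)) (β : Equiv.Perm (Fin k × Fin 3))
    (hβ : ∀ w i, β (w, i + 1) = ((β (w, i)).1, (β (w, i)).2 + 1))
    (he : ∀ h, e' (Equiv.sumCongr α β h) = Equiv.sumCongr α β (e h)) :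
    graphWeight φ e' (τ.trans α) = graphWeight φ e τ := by
  have : Equiv.sumCongr α β * e * (Equiv.sumCongr α β)⁻¹ = e' := by
    rw [mul_inv_eq_iff_eq_mul]
    exact Equiv.ext fun h => (he h).symm
  rw [graphWeight_eq_sum_conj φ e (Equiv.sumCongr α β) τ α fun u => rfl, this]
  simp only [labelWeight_comp_iso α β hβ]
  rfl

/-! ### Tensor-valued weights on `B_d`. -/

section Space

variable (K : Type*) [Field K] (V : Type*) [AddCommGroup V] [Module K V]

/-- The tensor-valued weight of a colored diagram. -/
def tensorWeight (φ : Fin n → Fin 3) (D : OpenJacobiDiagram V m k) : ⨂[K] _ : Fin n, V :=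
  ∑ τ : Fin n ≃ Fin m, (graphWeight φ D.edge τ : K) • PiTensorProduct.tprod K (D.color ∘ τ)

/-- The linear extension of `tensorWeight`. -/
def freeTensorWeight (d : ℕ) (φ : Fin n → Fin 3) :
    (DegreeDiagram V d →₀ K) →ₗ[K] ⨂[K] _ : Fin n, V :=
  Finsupp.linearCombination K fun D => tensorWeight K V φ D.2

variable {K V}

theorem freeTensorWeight_basisVec {d : ℕ} (φ : Fin n → Fin 3) (h : m + k = 2 * d)
    (D : OpenJacobiDiagram V m k) :
    freeTensorWeight K V d φ (basisVec K h D) = tensorWeight K V φ D := by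
  simp [freeTensorWeight, basisVec, toDegree]

theorem freeTensorWeight_relator {d : ℕ} (φ : Fin n → Fin 3) (x : DegreeDiagram V d →₀ K)
    (hx : Relator K V d x) : freeTensorWeight K V d φ x = 0 := by
  cases hx with
  | iso h D D' hD =>
    obtain ⟨α, β, hβ, he, hc⟩ := hD
    rw [map_sub, freeTensorWeight_basisVec, freeTensorWeight_basisVec, sub_eq_zero]
    refine Fintype.sum_equiv ((Equiv.refl _).equivCongr α) _ _ fun τ => ?_
    have h₁ : ((Equiv.refl _).equivCongr α) τ = τ.trans α := rfl
    have h₂ : D'.color ∘ (τ.trans α) = D.color ∘ τ := funext fun i => hc _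
    rw [h₁, graphWeight_iso φ D.edge D'.edge τ α β hβ he, h₂]
  | antisymm h w D D' hD =>
    rw [map_add, freeTensorWeight_basisVec, freeTensorWeight_basisVec, tensorWeight, tensorWeight,
      hD.1, hD.2, ← Finset.sum_add_distrib]
    refine Finset.sum_eq_zero fun τ _ => ?_
    rw [← add_smul, graphWeight_flip, Int.cast_neg, add_neg_cancel, zero_smul]
  | ihx h w w' hw D₁ D₂ D₃ he h₂ h₃ =>
    rw [map_add, map_add, freeTensorWeight_basisVec, freeTensorWeight_basisVec,
      freeTensorWeight_basisVec, tensorWeight, tensorWeight, tensorWeight,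
      h₃.1, h₃.2, h₂.1, h₂.2, ← Finset.sum_add_distrib, ← Finset.sum_add_distrib]
    refine Finset.sum_eq_zero fun τ _ => ?_
    rw [← add_smul, ← add_smul, ← Int.cast_add, ← Int.cast_add,
      graphWeight_ihx φ D₁.edge D₁.edge_edge τ w w' hw he rfl, Int.cast_zero, zero_smul]
  | multilinear h D u a b x y =>
    simp only [map_sub, map_smul, freeTensorWeight_basisVec, tensorWeight, withColor]
    rw [Finset.smul_sum, Finset.smul_sum, ← Finset.sum_sub_distrib, ← Finset.sum_sub_distrib]
    refine Finset.sum_eq_zero fun τ _ => ?_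
    have (z : V) : Function.update D.color u z ∘ τ =
        Function.update (D.color ∘ τ) (τ.symm u) z := by
      rw [← Function.update_comp_equiv]
    simp only [this, MultilinearMap.map_update_add, MultilinearMap.map_update_smul]
    module

/-- The tensor-valued weight system on `B_d`. -/
def B.weight (d : ℕ) (φ : Fin n → Fin 3) : B K V d →ₗ[K] ⨂[K] _ : Fin n, V :=
  (relations K V d).liftQ (freeTensorWeight K V d φ) <|
    Submodule.span_le.2 fun x hx => freeTensorWeight_relator φ x hx

theorem B.weight_diagramClass {d : ℕ} (φ : Fin n → Fin 3) (h : m + k = 2 * d)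
    (D : OpenJacobiDiagram V m k) :
    B.weight d φ (diagramClass (K := K) h D) = tensorWeight K V φ D :=
  ((relations K V d).liftQ_apply _ _).trans (freeTensorWeight_basisVec φ h D)

theorem B.weight_BRep {d : ℕ} (φ : Fin n → Fin 3) (g : LinearMap.GeneralLinearGroup K V)
    (x : B K V d) : B.weight d φ (BRep K V d g x) = tensorRep K V _ g (B.weight d φ x) := by
  have : B.weight d φ ∘ₗ BRep K V d g = tensorRep K V _ g ∘ₗ B.weight d φ :=
    B.ext_diagramClass fun m k h D => by
      rw [LinearMap.comp_apply, LinearMap.comp_apply]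
      erw [B.map_diagramClass]
      rw [B.weight_diagramClass, B.weight_diagramClass, tensorWeight, tensorWeight, map_sum]
      refine Finset.sum_congr rfl fun τ _ => ?_
      rw [map_smul]
      erw [PiTensorProduct.map_tprod]
      rfl
  exact LinearMap.congr_fun this x

/-- With a different number of legs there is no bijection to sum over. This separates the pieces
`B_{d,k}`. -/
theorem B.weight_eq_zero {d : ℕ} (φ : Fin n → Fin 3) (k : ℕ) (hk : n + k ≠ 2 * d) (x : B K V d)
    (hx : x ∈ (BGraded K V d k).toSubmodule) : B.weight d φ x = 0 := by
  induction hx using Submodule.span_induction with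
  | mem x hx =>
    obtain ⟨m, h, D, rfl⟩ := hx
    rw [B.weight_diagramClass, tensorWeight]
    refine Finset.sum_eq_zero fun τ _ => absurd (Fin.equiv_iff_eq.1 ⟨τ⟩) ?_
    omega
  | zero => exact map_zero _
  | add x y _ _ hx hy => rw [map_add, hx, hy, add_zero]
  | smul a x _ hx => rw [map_smul, hx, smul_zero]

end Space

end WeightSystem

/-! ### Relabelling diagrams into normal form. -/

section Relabel

variable {C : Type*} {m k : ℕ}

theorem reachable_conj (e σ : Equiv.Perm (HalfEdge m k)) (ν : Equiv.Perm (Fin m ⊕ Fin k))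
    (hν : ∀ h, HalfEdge.vertex (σ h) = ν (HalfEdge.vertex h)) {v w : Fin m ⊕ Fin k}
    (h : (adjacencyGraph e).Reachable v w) :
    (adjacencyGraph (σ * e * σ⁻¹ : Equiv.Perm (HalfEdge m k))).Reachable (ν v) (ν w) := by
  let F : adjacencyGraph e →g adjacencyGraph (σ * e * σ⁻¹ : Equiv.Perm (HalfEdge m k)) :=
    { toFun := ν
      map_rel' := by
        have key : ∀ a b, (∃ h, HalfEdge.vertex h = a ∧ HalfEdge.vertex (e h) = b) →
            ∃ h, HalfEdge.vertex h = ν a ∧ HalfEdge.vertex ((σ * e * σ⁻¹) h) = ν b := by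
          rintro _ _ ⟨h, rfl, rfl⟩
          exact ⟨σ h, hν h, by simp [hν]⟩
        intro a b hab
        rw [adjacencyGraph, SimpleGraph.fromRel_adj] at hab ⊢
        exact ⟨ν.injective.ne hab.1, hab.2.imp (key a b) (key b a)⟩ }
  exact h.map F

/-- Relabel the half-edges and the vertices of a diagram. -/
def OpenJacobiDiagram.conj (D : OpenJacobiDiagram C m k) (σ : Equiv.Perm (HalfEdge m k))
    (ν : Equiv.Perm (Fin m ⊕ Fin k)) (hν : ∀ h, HalfEdge.vertex (σ h) = ν (HalfEdge.vertex h))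
    (α : Equiv.Perm (Fin m)) (hα : ∀ u, ν (Sum.inl u) = Sum.inl (α u)) :
    OpenJacobiDiagram C m k where
  edge := σ * D.edge * σ⁻¹
  edge_edge h := by simp [D.edge_edge]
  edge_ne h := by
    rw [Equiv.Perm.mul_apply, Equiv.Perm.mul_apply, Ne, ← Equiv.Perm.eq_inv_iff_eq]
    exact D.edge_ne _
  color := D.color ∘ α.symm
  exists_univalent v := by
    obtain ⟨u, hu⟩ := D.exists_univalent (ν.symm v)
    refine ⟨α u, ?_⟩
    simpa [hα] using reachable_conj D.edge σ ν hν hu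

theorem vertex_flip (w : Fin k) (h : HalfEdge m k) :
    HalfEdge.vertex (flip w h) = HalfEdge.vertex h := by
  unfold OpenJacobiDiagram.flip
  rw [Equiv.swap_apply_def]
  split_ifs with h₁ h₂
  · rw [h₁]; rfl
  · rw [h₂]; rfl
  · rfl

/-- Reverse the cyclic order at a trivalent vertex. -/
def OpenJacobiDiagram.flipAt (D : OpenJacobiDiagram C m k) (w : Fin k) :
    OpenJacobiDiagram C m k :=
  D.conj (flip w) 1 (vertex_flip w) 1 fun _ => rfl

/-- The permutation of the half-edges at trivalent vertices given by a permutation of the vertices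
and a rotation at each vertex. -/
def slotPerm (π : Equiv.Perm (Fin k)) (r : Fin k → Fin 3) : Equiv.Perm (Fin k × Fin 3) where
  toFun p := (π p.1, r p.1 + p.2)
  invFun p := (π.symm p.1, p.2 - r (π.symm p.1))
  left_inv p := by simp
  right_inv p := by simp

/-- Pull back a diagram along a permutation of the trivalent vertices and a rotation at each of
them. -/
def OpenJacobiDiagram.pull (D : OpenJacobiDiagram C m k) (π : Equiv.Perm (Fin k))
    (r : Fin k → Fin 3) : OpenJacobiDiagram C m k :=
  D.conj (Equiv.sumCongr 1 (slotPerm π r))⁻¹ (Equiv.sumCongr 1 π)⁻¹ (fun h => by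
    rw [Equiv.Perm.eq_inv_iff_eq]
    obtain ⟨h, rfl⟩ := (Equiv.sumCongr (1 : Equiv.Perm (Fin m)) (slotPerm π r)).surjective h
    rw [Equiv.Perm.inv_def, Equiv.symm_apply_apply]
    rcases h with u | p <;> rfl) 1 fun _ => rfl

theorem pull_iso (D : OpenJacobiDiagram C m k) (π : Equiv.Perm (Fin k)) (r : Fin k → Fin 3) :
    (D.pull π r).Iso D :=
  ⟨1, slotPerm π r, fun w i => Prod.ext rfl (add_assoc _ _ _).symm,
    fun h => by simp [pull, OpenJacobiDiagram.conj], fun u => rfl⟩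

/-- The half-edge of `D` corresponding to a half-edge of `D.pull π r`. -/
def pullHalfEdge (π : Equiv.Perm (Fin k)) (r : Fin k → Fin 3) (h : HalfEdge m k) : HalfEdge m k :=
  Equiv.sumCongr 1 (slotPerm π r) h

theorem pullHalfEdge_inl (π : Equiv.Perm (Fin k)) (r : Fin k → Fin 3) (u : Fin m) :
    pullHalfEdge π r (Sum.inl u) = Sum.inl u := rfl

theorem pullHalfEdge_slot (π : Equiv.Perm (Fin k)) (r : Fin k → Fin 3) (w : Fin k) (i : Fin 3) :
    (pullHalfEdge π r (slot w i) : HalfEdge m k) = slot (π w) (r w + i) := rfl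

theorem pull_edge_eq_iff (D : OpenJacobiDiagram C m k) (π : Equiv.Perm (Fin k))
    (r : Fin k → Fin 3) (h h' : HalfEdge m k) :
    (D.pull π r).edge h = h' ↔ D.edge (pullHalfEdge π r h) = pullHalfEdge π r h' := by
  simp only [pull, OpenJacobiDiagram.conj, inv_inv, Equiv.Perm.mul_apply, Equiv.Perm.inv_eq_iff_eq]
  rfl

theorem eq_of_edge_of_color {D D' : OpenJacobiDiagram C m k} (h : D.edge = D'.edge)
    (h' : D.color = D'.color) : D = D' := by
  cases D; cases D'; simp_all

theorem eq_withColor_of_edge {C' : Type*} {D : OpenJacobiDiagram C m k}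
    {R : OpenJacobiDiagram C' m k}
    (h : ∀ x, D.edge x = R.edge x) : D = R.withColor D.color :=
  eq_of_edge_of_color (Equiv.ext h) rfl

/-- A set of vertices closed under the edges which contains no univalent vertex is empty. -/
theorem not_mem_of_closed (D : OpenJacobiDiagram C m k) (S : Set (Fin m ⊕ Fin k))
    (hS : ∀ h, HalfEdge.vertex h ∈ S → HalfEdge.vertex (D.edge h) ∈ S)
    (hu : ∀ u, Sum.inl u ∉ S) (v : Fin m ⊕ Fin k) : v ∉ S := by
  intro hv
  obtain ⟨u, ⟨p⟩⟩ := D.exists_univalent v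
  refine hu u ?_
  generalize (Sum.inl u : Fin m ⊕ Fin k) = z at p
  induction p with
  | nil => exact hv
  | cons hadj _ ih =>
    refine ih ?_
    rw [adjacencyGraph, SimpleGraph.fromRel_adj] at hadj
    rcases hadj.2 with ⟨h, rfl, rfl⟩ | ⟨h, rfl, rfl⟩
    · exact hS h hv
    · simpa [D.edge_edge] using hS _ hv

end Relabel

/-! ### Consequences of isomorphism and AS for classes in `B_d`. -/

section Class

variable {K : Type*} [Field K] {V : Type*} [AddCommGroup V] [Module K V] {m k d : ℕ}

theorem diagramClass_eq_of_iso (h : m + k = 2 * d) {D D' : OpenJacobiDiagram V m k}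
    (hD : D.Iso D') : (diagramClass h D : B K V d) = diagramClass h D' := by
  rw [← sub_eq_zero, diagramClass, diagramClass, ← map_sub]
  exact (Submodule.Quotient.mk_eq_zero _).2 (Submodule.subset_span (.iso h D D' hD))

theorem diagramClass_pull (h : m + k = 2 * d) (D : OpenJacobiDiagram V m k)
    (π : Equiv.Perm (Fin k)) (r : Fin k → Fin 3) :
    (diagramClass h (D.pull π r) : B K V d) = diagramClass h D :=
  diagramClass_eq_of_iso h (pull_iso D π r)

theorem diagramClass_of_movedBy_flip (h : m + k = 2 * d) (w : Fin k)
    {D D' : OpenJacobiDiagram V m k} (hD : MovedBy (flip w) D D') :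
    (diagramClass h D' : B K V d) = -diagramClass h D := by
  rw [eq_neg_iff_add_eq_zero, add_comm, diagramClass, diagramClass, ← map_add]
  exact (Submodule.Quotient.mk_eq_zero _).2 (Submodule.subset_span (.antisymm h w D D' hD))

theorem diagramClass_flipAt (h : m + k = 2 * d) (D : OpenJacobiDiagram V m k) (w : Fin k) :
    (diagramClass h (D.flipAt w) : B K V d) = -diagramClass h D :=
  diagramClass_of_movedBy_flip h w ⟨rfl, rfl⟩

variable [CharZero K]

/-- AS makes the class its own negative, and 2 is invertible. -/
theorem diagramClass_eq_zero_of_movedBy_flip (h : m + k = 2 * d) (w : Fin k)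
    {D D' : OpenJacobiDiagram V m k} (hD : MovedBy (flip w) D D')
    (hcl : (diagramClass h D' : B K V d) = diagramClass h D) :
    (diagramClass h D : B K V d) = 0 := by
  have h₂ := eq_neg_iff_add_eq_zero.1 (hcl.symm.trans (diagramClass_of_movedBy_flip h w hD))
  rw [← two_smul K] at h₂
  exact (smul_eq_zero.1 h₂).resolve_left two_ne_zero

/-- A diagram with a loop at a trivalent vertex vanishes. -/
theorem diagramClass_eq_zero_of_loop (h : m + k = 2 * d) (D : OpenJacobiDiagram V m k) (w : Fin k)
    (i j : Fin 3) (hD : D.edge (slot w i) = slot w j) : (diagramClass h D : B K V d) = 0 := by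
  have key : ∀ i j : Fin 3, i ≠ j → (∃ r, r + 1 = i ∧ r + 2 = j) ∨ ∃ r, r + 1 = j ∧ r + 2 = i := by
    decide
  obtain ⟨r, hr⟩ : ∃ r : Fin 3, D.edge (slot w (r + 1)) = slot w (r + 2) := by
    have hij : i ≠ j := fun hij => D.edge_ne (slot w i) (by rw [hD, hij])
    rcases key i j hij with ⟨r, rfl, rfl⟩ | ⟨r, rfl, rfl⟩
    · exact ⟨r, hD⟩
    · exact ⟨r, by rw [← hD, D.edge_edge]⟩
  -- With `r` the slot outside the loop, rotating by `r` puts the loop in slots 1 and 2. The flip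
  -- exchanges these and so preserves the graph.
  rw [← diagramClass_pull h D 1 fun _ => r]
  have h₁ : (D.pull 1 fun _ => r).edge (slot w 1) = slot w 2 := (pull_edge_eq_iff ..).2 hr
  have h₂ : (D.pull 1 fun _ => r).edge (slot w 2) = slot w 1 := by rw [← h₁, edge_edge]
  refine diagramClass_eq_zero_of_movedBy_flip h w ⟨?_, rfl⟩ rfl
  rw [OpenJacobiDiagram.flip, Equiv.swap_inv, mul_assoc, Equiv.mul_swap_eq_swap_mul, h₁, h₂,
    Equiv.swap_comm (slot w 2), Equiv.swap_mul_self_mul]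

theorem edge_slot_ne_of_ne_zero (h : m + k = 2 * d) {D : OpenJacobiDiagram V m k}
    (hD : (diagramClass h D : B K V d) ≠ 0) (w : Fin k) (i j : Fin 3) :
    D.edge (slot w i) ≠ slot w j :=
  fun hij => hD (diagramClass_eq_zero_of_loop h D w i j hij)

end Class

/-! ### The colorings of a fixed graph as a linear map on a tensor power. -/

section Colorings

variable (K : Type*) [Field K] (V : Type*) [AddCommGroup V] [Module K V] {C : Type*} {m k d : ℕ}

/-- The colorings of a graph, as a multilinear function of the colors. -/
def coloringsMultilinear (h : m + k = 2 * d) (R : OpenJacobiDiagram C m k) :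
    MultilinearMap K (fun _ : Fin m => V) (B K V d) :=
  have key (v : Fin m → V) (u : Fin m) (a b : K) (x y : V) :
      diagramClass h (R.withColor (Function.update v u (a • x + b • y))) =
        a • diagramClass h (R.withColor (Function.update v u x)) +
          b • (diagramClass h (R.withColor (Function.update v u y)) : B K V d) := by
    rw [← sub_eq_zero, ← sub_sub]
    simp only [diagramClass, ← map_smul, ← map_sub]
    exact (Submodule.Quotient.mk_eq_zero _).2
      (Submodule.subset_span (.multilinear h (R.withColor v) u a b x y))
  { toFun := fun v => diagramClass h (R.withColor v)
    map_update_add' := fun v u x y => by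
      have := key v u 1 1 x y
      simp only [one_smul] at this
      convert this
    map_update_smul' := fun v u a x => by
      have := key v u a 0 x 0
      simp only [zero_smul, add_zero] at this
      convert this }

/-- The linear map from the tensor power of `V` given by the colorings of a graph. -/
def colorings (h : m + k = 2 * d) (R : OpenJacobiDiagram C m k) :
    (⨂[K] _ : Fin m, V) →ₗ[K] B K V d :=
  PiTensorProduct.lift (coloringsMultilinear K V h R)

variable {K V}

theorem colorings_tprod (h : m + k = 2 * d) (R : OpenJacobiDiagram C m k) (v : Fin m → V) :
    colorings K V h R (PiTensorProduct.tprod K v) = diagramClass h (R.withColor v) :=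
  PiTensorProduct.lift.tprod v

theorem range_colorings_le (h : m + k = 2 * d) (R : OpenJacobiDiagram C m k)
    (S : Submodule K (B K V d)) (hS : ∀ v : Fin m → V, diagramClass h (R.withColor v) ∈ S) :
    LinearMap.range (colorings K V h R) ≤ S := by
  rintro _ ⟨t, rfl⟩
  induction t using PiTensorProduct.induction_on with
  | smul_tprod a v => rw [map_smul, colorings_tprod]; exact S.smul_mem a (hS v)
  | add x y hx hy => rw [map_add]; exact S.add_mem hx hy

theorem diagramClass_withColor_mem_range (h : m + k = 2 * d) (R : OpenJacobiDiagram C m k)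
    (v : Fin m → V) : diagramClass h (R.withColor v) ∈ LinearMap.range (colorings K V h R) :=
  ⟨_, colorings_tprod h R v⟩

theorem BGraded_eq_range (h : m + k = 2 * d) (R : OpenJacobiDiagram C m k)
    (hR : ∀ D : OpenJacobiDiagram V m k, diagramClass h D ∈ LinearMap.range (colorings K V h R)) :
    (BGraded K V d k).toSubmodule = LinearMap.range (colorings K V h R) := by
  refine le_antisymm (Submodule.span_le.2 ?_)
    (range_colorings_le h R _ fun v => Submodule.subset_span ⟨m, h, _, rfl⟩)
  rintro _ ⟨m', h', D, rfl⟩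
  obtain rfl : m = m' := by omega
  exact hR D

theorem BGraded_eq_BConnected (h : m + k = 2 * d) (R : OpenJacobiDiagram C m k)
    (hR : ∀ D : OpenJacobiDiagram V m k, diagramClass h D ∈ LinearMap.range (colorings K V h R))
    (hconn : R.IsConnected) :
    (BGraded K V d k).toSubmodule = BConnected K V d k := by
  refine le_antisymm ?_ (Submodule.span_mono ?_)
  · rw [BGraded_eq_range h R hR]
    exact range_colorings_le h R _ fun v => Submodule.subset_span ⟨m, h, _, hconn, rfl⟩
  · rintro _ ⟨m', h', D, -, rfl⟩
    exact ⟨m', h', D, rfl⟩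

/-- This is the composite `g ∘ f`: the graph enters only through its weights, as coefficients of a
group algebra element. -/
theorem weight_colorings (h : m + k = 2 * d) (R : OpenJacobiDiagram C m k) (φ : Fin m → Fin 3)
    (t : ⨂[K] _ : Fin m, V) :
    B.weight d φ (colorings K V h R t) = symmetrize K V (graphWeight φ R.edge) t := by
  have : B.weight d φ ∘ₗ colorings K V h R = symmetrize K V (graphWeight φ R.edge) :=
    PiTensorProduct.ext <| MultilinearMap.ext fun v => by
      rw [LinearMap.compMultilinearMap_apply, LinearMap.compMultilinearMap_apply,
        LinearMap.comp_apply, colorings_tprod, B.weight_diagramClass, symmetrize_tprod]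
      rfl
  exact LinearMap.congr_fun this t

/-- This is the source of `f ∘ g ∘ f = c • f`. The hypothesis holds when every permutation of
nonzero weight is a symmetry of the graph up to sign, and `c` is the sum of the `s τ`. -/
theorem colorings_weight_colorings (h : m + k = 2 * d) (R : OpenJacobiDiagram C m k)
    (φ : Fin m → Fin 3) (s : Equiv.Perm (Fin m) → ℤ)
    (hs : ∀ (τ : Equiv.Perm (Fin m)) (v : Fin m → V), (graphWeight φ R.edge τ : K) •
      (diagramClass h (R.withColor (v ∘ τ)) : B K V d) =
        (s τ : K) • diagramClass h (R.withColor v))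
    (t : ⨂[K] _ : Fin m, V) :
    colorings K V h R (B.weight d φ (colorings K V h R t)) =
      ((∑ τ, s τ : ℤ) : K) • colorings K V h R t := by
  have : colorings K V h R ∘ₗ symmetrize K V (graphWeight φ R.edge) =
      ((∑ τ, s τ : ℤ) : K) • colorings K V h R :=
    PiTensorProduct.ext <| MultilinearMap.ext fun v => by
      rw [LinearMap.compMultilinearMap_apply, LinearMap.compMultilinearMap_apply,
        LinearMap.comp_apply, LinearMap.smul_apply, symmetrize_tprod, map_sum, Int.cast_sum,
        Finset.sum_smul]
      refine Finset.sum_congr rfl fun τ _ => ?_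
      rw [map_smul, colorings_tprod, colorings_tprod, hs]
  rw [weight_colorings]
  exact LinearMap.congr_fun this t

end Colorings

/-! ### The reference graphs: two struts, tripod, wheel. -/

section Reference

/-- Two disjoint edges. -/
def twoStruts : OpenJacobiDiagram Unit 4 0 where
  edge := Equiv.sumCongr squareSwap 1
  edge_edge := by decide
  edge_ne := by decide
  color _ := ()
  exists_univalent v := by
    rcases v with u | w
    · exact ⟨u, .refl _⟩
    · exact w.elim0

/-- The edges of the tripod. -/
def tripodEdge : HalfEdge 3 1 → HalfEdge 3 1 :=
  Sum.elim (fun u => slot 0 u) fun p => Sum.inl p.2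

theorem tripodEdge_involutive : Function.Involutive tripodEdge := by
  unfold Function.Involutive
  decide

theorem adj_of_edge {m k : ℕ} (e : HalfEdge m k → HalfEdge m k) (h : HalfEdge m k)
    (hh : HalfEdge.vertex h ≠ HalfEdge.vertex (e h)) :
    (adjacencyGraph e).Adj (HalfEdge.vertex h) (HalfEdge.vertex (e h)) := by
  rw [adjacencyGraph, SimpleGraph.fromRel_adj]
  exact ⟨hh, .inl ⟨h, rfl, rfl⟩⟩

theorem tripodEdge_reachable (v : Fin 3 ⊕ Fin 1) :
    (adjacencyGraph tripodEdge).Reachable v (Sum.inr 0) := by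
  rcases v with u | w
  · exact (adj_of_edge tripodEdge (Sum.inl u) (by simp [tripodEdge, HalfEdge.vertex])).reachable
  · rw [Subsingleton.elim w 0]

/-- The tripod. -/
def tripod : OpenJacobiDiagram Unit 3 1 where
  edge := tripodEdge_involutive.toPerm
  edge_edge := tripodEdge_involutive
  edge_ne := by simp only [Function.Involutive.coe_toPerm]; decide
  color _ := ()
  exists_univalent v := ⟨0, (tripodEdge_reachable v).trans (tripodEdge_reachable _).symm⟩

theorem tripod_isConnected : tripod.IsConnected :=
  ⟨fun v w => (tripodEdge_reachable v).trans (tripodEdge_reachable w).symm⟩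

/-- The edges of the wheel with two legs. -/
def wheelEdge : HalfEdge 2 2 → HalfEdge 2 2 :=
  Sum.elim (fun u => slot u 0) fun p => if p.2 = 0 then Sum.inl p.1 else slot (p.1 + 1) p.2

theorem wheelEdge_involutive : Function.Involutive wheelEdge := by
  unfold Function.Involutive
  decide

theorem wheelEdge_reachable (v : Fin 2 ⊕ Fin 2) :
    (adjacencyGraph wheelEdge).Reachable v (Sum.inr 0) := by
  have h : ∀ w : Fin 2, (adjacencyGraph wheelEdge).Reachable (Sum.inr w) (Sum.inr 0) := fun w => by
    fin_cases w
    · exact .refl _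
    · exact (adj_of_edge wheelEdge (slot 1 1) (by decide)).reachable
  rcases v with u | w
  · exact (adj_of_edge wheelEdge (Sum.inl u)
      (by simp [wheelEdge, HalfEdge.vertex])).reachable.trans (h u)
  · exact h w

/-- The wheel with two legs. -/
def wheel : OpenJacobiDiagram Unit 2 2 where
  edge := wheelEdge_involutive.toPerm
  edge_edge := wheelEdge_involutive
  edge_ne := by simp only [Function.Involutive.coe_toPerm]; decide
  color _ := ()
  exists_univalent v := ⟨0, (wheelEdge_reachable v).trans (wheelEdge_reachable _).symm⟩

theorem wheel_isConnected : wheel.IsConnected :=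
  ⟨fun v w => (wheelEdge_reachable v).trans (wheelEdge_reachable w).symm⟩

end Reference

/-! ### Weights of the reference graphs. -/

section Weights

/-- All half-edges are legs, so the labelling is determined: leg `u` carries the row of `τ⁻¹ u`. It
is admissible exactly when both ends of each strut agree. -/
theorem graphWeight_twoStruts (τ : Equiv.Perm (Fin 4)) :
    graphWeight squareRow twoStruts.edge τ = dihedralWeight τ := by
  have hl (l : HalfEdge 4 0 → Fin 3) : labelWeight l = 1 := by simp [labelWeight]
  simp only [graphWeight, hl, dihedralWeight]
  have huniq : ∀ l, IsLabelling squareRow twoStruts.edge τ l →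
      l = Sum.elim (squareRow ∘ τ.symm) fun p => p.1.elim0 := fun l hl => by
    ext x
    rcases x with u | p
    · have := hl.2 (τ.symm u)
      rw [Equiv.apply_symm_apply] at this
      rw [this]; rfl
    · exact p.1.elim0
  split_ifs with h
  · have : (Finset.univ.filter (IsLabelling squareRow twoStruts.edge τ)) =
        {Sum.elim (squareRow ∘ τ.symm) fun p => p.1.elim0} := by
      refine Finset.eq_singleton_iff_unique_mem.2 ⟨?_, fun l hl =>
        huniq l (Finset.mem_filter.1 hl).2⟩
      refine Finset.mem_filter.2 ⟨Finset.mem_univ _, fun x => ?_, fun i => by simp⟩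
      rcases x with u | p
      · exact h u
      · exact p.1.elim0
    rw [this, Finset.sum_singleton]
  · refine Finset.sum_eq_zero fun l hl => absurd ?_ h
    have hl := (Finset.mem_filter.1 hl).2
    intro j
    have h₁ := hl.1 (Sum.inl j)
    rw [huniq l hl] at h₁
    exact h₁

theorem leviCivita_inv : ∀ τ : Equiv.Perm (Fin 3),
    leviCivita (τ⁻¹ 0) (τ⁻¹ 1) (τ⁻¹ 2) = (Equiv.Perm.sign τ : ℤ) := by
  decide +kernel

theorem graphWeight_tripod (τ : Equiv.Perm (Fin 3)) :
    graphWeight id tripod.edge τ = (Equiv.Perm.sign τ : ℤ) := by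
  have : (Finset.univ.filter (IsLabelling id tripod.edge τ)) =
      {Sum.elim (τ⁻¹ : Equiv.Perm (Fin 3)) fun p => τ⁻¹ p.2} := by
    refine Finset.eq_singleton_iff_unique_mem.2 ⟨?_, fun l hl => ?_⟩
    · refine Finset.mem_filter.2 ⟨Finset.mem_univ _, fun x => ?_, fun i => by simp⟩
      rcases x with u | p <;> rfl
    · have hl := (Finset.mem_filter.1 hl).2
      have h₁ (u : Fin 3) : l (Sum.inl u) = τ⁻¹ u := by
        simpa using hl.2 (τ⁻¹ u)
      ext x
      rcases x with u | p
      · rw [h₁]; rfl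
      · have h₂ := hl.1 (Sum.inr p)
        have h₃ : tripod.edge (Sum.inr p) = Sum.inl p.2 := rfl
        rw [h₃, h₁] at h₂
        rw [← h₂]; rfl
  rw [graphWeight, this, Finset.sum_singleton, ← leviCivita_inv]
  simp [labelWeight]

/-- The labelling of the wheel with given labels on the two parallel edges. -/
def wheelLabel (p : Fin 3 × Fin 3) : HalfEdge 2 2 → Fin 3 :=
  Sum.elim (fun _ => 0) fun q => ![0, p.1, p.2] q.2

theorem graphWeight_wheel (τ : Equiv.Perm (Fin 2)) :
    graphWeight (fun _ => 0) wheel.edge τ = 2 := by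
  -- The parallel edges join equal slots, so both vertices contribute the same symbol. The sum of
  -- the squares of `leviCivita 0 p.1 p.2` is 2.
  have h₀ : ∑ p, labelWeight (wheelLabel p) = 2 := by decide +kernel
  rw [graphWeight, ← h₀]
  symm
  refine Finset.sum_bij (fun p _ => wheelLabel p) (fun p _ => ?_) (fun p _ q _ hpq => ?_)
    (fun l hl => ?_) fun _ _ => rfl
  · refine Finset.mem_filter.2 ⟨Finset.mem_univ _, fun x => ?_, fun i => rfl⟩
    rcases x with u | ⟨w, i⟩
    · rfl
    · fin_cases i <;> rfl
  · exact Prod.ext (congrFun hpq (slot 0 1)) (congrFun hpq (slot 0 2))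
  · have hl := (Finset.mem_filter.1 hl).2
    have h₁ (u : Fin 2) : l (Sum.inl u) = 0 := by
      simpa using hl.2 (τ⁻¹ u)
    refine ⟨(l (slot 0 1), l (slot 0 2)), Finset.mem_univ _, ?_⟩
    ext x
    rcases x with u | ⟨w, i⟩
    · rw [h₁]; rfl
    · fin_cases i
      · exact congrArg Fin.val ((h₁ w).symm.trans (hl.1 (Sum.inr (w, 0))))
      · fin_cases w
        · rfl
        · exact congrArg Fin.val (hl.1 (Sum.inr (1, 1)))
      · fin_cases w
        · rfl
        · exact congrArg Fin.val (hl.1 (Sum.inr (1, 2)))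

end Weights

/-! ### Symmetries of the reference graphs. -/

section Symmetries

variable {K : Type*} [Field K] {V : Type*} [AddCommGroup V] [Module K V]

theorem diagramClass_twoStruts_comp (h₀ : 4 + 0 = 2 * 2) (τ : Equiv.Perm (Fin 4))
    (hτ : τ * squareSwap = squareSwap * τ) (v : Fin 4 → V) :
    (diagramClass h₀ (twoStruts.withColor (v ∘ τ)) : B K V 2) =
      diagramClass h₀ (twoStruts.withColor v) := by
  refine diagramClass_eq_of_iso _ ⟨τ, 1, fun w => w.elim0, fun h => ?_, fun u => rfl⟩
  rcases h with u | p
  · exact congrArg Sum.inl (Equiv.congr_fun hτ.symm u)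
  · exact p.1.elim0

theorem diagramClass_tripod_comp (h₀ : 3 + 1 = 2 * 2) (τ : Equiv.Perm (Fin 3)) (v : Fin 3 → V) :
    (diagramClass h₀ (tripod.withColor (v ∘ τ)) : B K V 2) =
      ((Equiv.Perm.sign τ : ℤ) : K) • diagramClass h₀ (tripod.withColor v) := by
  have hrot (r : Fin 3) (v : Fin 3 → V) :
      (diagramClass h₀ (tripod.withColor (v ∘ Equiv.addLeft r)) : B K V 2) =
        diagramClass h₀ (tripod.withColor v) := by
    refine diagramClass_eq_of_iso _ ⟨Equiv.addLeft r, slotPerm 1 fun _ => r,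
      fun w i => Prod.ext rfl (add_assoc _ _ _).symm, fun h => ?_, fun u => rfl⟩
    rcases h with u | ⟨w, i⟩
    · rfl
    · rfl
  have hswap (v : Fin 3 → V) :
      (diagramClass h₀ (tripod.withColor (v ∘ Equiv.swap 1 2)) : B K V 2) =
        -diagramClass h₀ (tripod.withColor v) := by
    rw [← diagramClass_flipAt _ _ 0]
    refine diagramClass_eq_of_iso _ ⟨Equiv.swap 1 2, 1, fun w i => rfl, ?_, fun u => rfl⟩
    have : ∀ h : HalfEdge 3 1, flip 0 (tripodEdge (flip 0 (Equiv.sumCongr (Equiv.swap 1 2) 1 h))) =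
      Equiv.sumCongr (Equiv.swap 1 2) 1 (tripodEdge h) := by decide
    exact this
  -- Rotations are isomorphisms of the tripod, and one transposition costs a sign by AS; together
  -- they give all of `𝔖_3`.
  have hτ : ∀ τ : Equiv.Perm (Fin 3), ∃ r : Fin 3, (Equiv.Perm.sign τ = 1 ∧ τ = Equiv.addLeft r) ∨
      (Equiv.Perm.sign τ = -1 ∧ τ = Equiv.addLeft r * Equiv.swap 1 2) := by decide +kernel
  obtain ⟨r, ⟨hs, rfl⟩ | ⟨hs, rfl⟩⟩ := hτ τ
  · rw [hrot, hs]; simp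
  · rw [hs, Equiv.Perm.coe_mul, ← Function.comp_assoc, hswap, hrot]; simp

theorem diagramClass_wheel_comp (h₀ : 2 + 2 = 2 * 2) (τ : Equiv.Perm (Fin 2)) (v : Fin 2 → V) :
    (diagramClass h₀ (wheel.withColor (v ∘ τ)) : B K V 2) =
      diagramClass h₀ (wheel.withColor v) := by
  refine diagramClass_eq_of_iso _ ⟨τ, slotPerm τ fun _ => 0, fun w i => by simp [slotPerm], ?_,
    fun u => rfl⟩
  have : ∀ (τ : Equiv.Perm (Fin 2)) (h : HalfEdge 2 2),
      wheelEdge (Equiv.sumCongr τ (slotPerm τ fun _ => 0) h) =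
        Equiv.sumCongr τ (slotPerm τ fun _ => 0) (wheelEdge h) := by decide +kernel
  exact this τ

end Symmetries

/-! ### Classification of the diagrams of degree 2. -/

section Classification

variable {K : Type*} [Field K] {V : Type*} [AddCommGroup V] [Module K V]
  {C : Type*}

theorem exists_twoStruts_iso (D : OpenJacobiDiagram C 4 0) :
    ∃ v : Fin 4 → C, (twoStruts.withColor v).Iso D := by
  have h (u : Fin 4) : ∃ u', D.edge (Sum.inl u) = Sum.inl u' := by
    rcases D.edge (Sum.inl u) with u' | p
    · exact ⟨u', rfl⟩
    · exact p.1.elim0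
  choose q hq using h
  -- All fixed-point free involutions of four points are conjugate to `squareSwap`.
  have key : ∀ q : Fin 4 → Fin 4, (∀ i, q (q i) = i) → (∀ i, q i ≠ i) →
      ∃ τ : Equiv.Perm (Fin 4), ∀ i, q (τ i) = τ (squareSwap i) := by decide +kernel
  obtain ⟨τ, hτ⟩ := key q
    (fun i => by have := D.edge_edge (Sum.inl i); rw [hq, hq] at this; exact Sum.inl_injective this)
    (fun i hi => D.edge_ne (Sum.inl i) (by rw [hq, hi]))
  refine ⟨D.color ∘ τ, τ, 1, fun w => w.elim0, fun x => ?_, fun u => rfl⟩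
  rcases x with u | p
  · exact (hq _).trans (congrArg Sum.inl (hτ u))
  · exact p.1.elim0

theorem diagramClass_mem_range_twoStruts (h₀ : 4 + 0 = 2 * 2) (D : OpenJacobiDiagram V 4 0) :
    diagramClass h₀ D ∈ LinearMap.range (colorings K V h₀ twoStruts) := by
  obtain ⟨v, hv⟩ := exists_twoStruts_iso D
  rw [← diagramClass_eq_of_iso h₀ hv]
  exact diagramClass_withColor_mem_range h₀ twoStruts v

theorem exists_tripod_iso (D : OpenJacobiDiagram C 3 1)
    (hD : ∀ i j, D.edge (slot 0 i) ≠ slot 0 j) : ∃ v : Fin 3 → C, (tripod.withColor v).Iso D := by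
  have h (i : Fin 3) : ∃ u, D.edge (slot 0 i) = Sum.inl u := by
    rcases hx : D.edge (slot 0 i) with u | ⟨w, j⟩
    · exact ⟨u, rfl⟩
    · exact absurd (by rw [hx, Subsingleton.elim w 0]) (hD i j)
  choose q hq using h
  have hinj : Function.Injective q := fun i j hij => by
    have : (slot 0 i : HalfEdge 3 1) = slot 0 j := D.edge.injective (by rw [hq, hq, hij])
    simpa [slot] using this
  refine ⟨D.color ∘ q, Equiv.ofBijective q (Finite.injective_iff_bijective.1 hinj), 1,
    fun w i => rfl, fun x => ?_, fun u => rfl⟩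
  rcases x with u | ⟨w, i⟩
  · have := D.edge_edge (slot 0 u)
    rw [hq] at this
    exact this
  · rw [Subsingleton.elim w 0]
    exact hq i

variable [CharZero K]

theorem diagramClass_mem_range_tripod (h₀ : 3 + 1 = 2 * 2) (D : OpenJacobiDiagram V 3 1) :
    diagramClass h₀ D ∈ LinearMap.range (colorings K V h₀ tripod) := by
  by_cases hD : (diagramClass h₀ D : B K V 2) = 0
  · rw [hD]; exact zero_mem _
  obtain ⟨v, hv⟩ := exists_tripod_iso D (edge_slot_ne_of_ne_zero h₀ hD 0)
  rw [← diagramClass_eq_of_iso h₀ hv]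
  exact diagramClass_withColor_mem_range h₀ tripod v

/-- If the two legs were joined, the trivalent vertices would be cut off from every univalent
vertex. -/
theorem edge_inl_ne_inl (D : OpenJacobiDiagram C 2 2) : D.edge (Sum.inl 0) ≠ Sum.inl 1 := by
  intro h₀₁
  have h₁₀ : D.edge (Sum.inl 1) = Sum.inl 0 := by rw [← h₀₁, D.edge_edge]
  refine not_mem_of_closed D (Set.range Sum.inr) ?_ (by simp) (Sum.inr 0) ⟨0, rfl⟩
  rintro (u | p) ⟨w, hw⟩
  · cases hw
  · rcases hx : D.edge (Sum.inr p) with u | q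
    · have := D.edge_edge (Sum.inr p)
      rw [hx] at this
      fin_cases u
      · exact absurd (h₀₁.symm.trans this) (by simp)
      · exact absurd (h₁₀.symm.trans this) (by simp)
    · exact ⟨q.1, rfl⟩

theorem wheel_of_edge (D : OpenJacobiDiagram C 2 2) (h₀ : D.edge (Sum.inl 0) = slot 0 0)
    (h₁ : D.edge (Sum.inl 1) = slot 1 0) (h₂ : D.edge (slot 0 1) = slot 1 1)
    (h₃ : D.edge (slot 0 2) = slot 1 2) : D = wheel.withColor D.color := by
  have h₀' : D.edge (slot 0 0) = Sum.inl 0 := by rw [← h₀, D.edge_edge]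
  have h₁' : D.edge (slot 1 0) = Sum.inl 1 := by rw [← h₁, D.edge_edge]
  have h₂' : D.edge (slot 1 1) = slot 0 1 := by rw [← h₂, D.edge_edge]
  have h₃' : D.edge (slot 1 2) = slot 0 2 := by rw [← h₃, D.edge_edge]
  refine eq_withColor_of_edge fun x => ?_
  rcases x with u | ⟨w, i⟩
  · fin_cases u
    · exact h₀
    · exact h₁
  · fin_cases w <;> fin_cases i
    exacts [h₀', h₂, h₃, h₁', h₂', h₃']

/-- If both legs sit at distinct vertices, in slot `0`, and no loops appear, the diagram is a wheel
up to sign. -/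
theorem diagramClass_mem_range_wheel_of_edge (h : 2 + 2 = 2 * 2) (D : OpenJacobiDiagram V 2 2)
    (hD : (diagramClass h D : B K V 2) ≠ 0)
    (h₀ : D.edge (Sum.inl 0) = slot 0 0) (h₁ : D.edge (Sum.inl 1) = slot 1 0) :
    diagramClass h D ∈ LinearMap.range (colorings K V h wheel) := by
  have hloop := edge_slot_ne_of_ne_zero h hD
  have h₀' : D.edge (slot 0 0) = Sum.inl 0 := by rw [← h₀, D.edge_edge]
  have h₁' : D.edge (slot 1 0) = Sum.inl 1 := by rw [← h₁, D.edge_edge]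
  have key : ∀ i : Fin 3, i ≠ 0 → ∃ j, j ≠ 0 ∧ D.edge (slot 0 i) = slot 1 j := fun i hi => by
    rcases hx : D.edge (slot 0 i) with u | ⟨w, j⟩
    · have hx' := D.edge_edge (slot 0 i)
      rw [hx] at hx'
      fin_cases u
      · exact absurd (h₀.symm.trans hx') (by simp [slot, hi.symm])
      · exact absurd (h₁.symm.trans hx') (by simp [slot])
    · fin_cases w
      · exact absurd hx (hloop 0 i j)
      · refine ⟨j, ?_, rfl⟩
        rintro rfl
        have hx' := D.edge_edge (slot 0 i)
        rw [hx] at hx'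
        exact absurd (h₁'.symm.trans hx') (by simp [slot])
  obtain ⟨i, hi, hi'⟩ := key 1 (by decide)
  obtain ⟨j, hj, hj'⟩ := key 2 (by decide)
  have hij : i ≠ j := by
    rintro rfl
    have := D.edge.injective (hi'.trans hj'.symm)
    simp [slot] at this
  have hcases : ∀ i j : Fin 3, i ≠ 0 → j ≠ 0 → i ≠ j → (i = 1 ∧ j = 2) ∨ (i = 2 ∧ j = 1) := by
    decide
  rcases hcases i j hi hj hij with ⟨rfl, rfl⟩ | ⟨rfl, rfl⟩
  · rw [wheel_of_edge D h₀ h₁ hi' hj']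
    exact diagramClass_withColor_mem_range h wheel _
  -- The parallel edges are crossed here; reversing the order at vertex 1 uncrosses them at the cost
  -- of a sign.
  · rw [← neg_neg (diagramClass h D), ← diagramClass_flipAt h D 1,
      wheel_of_edge (D.flipAt 1) ?_ ?_ ?_ ?_]
    · exact neg_mem (diagramClass_withColor_mem_range h wheel _)
    all_goals simp [flipAt, OpenJacobiDiagram.conj, OpenJacobiDiagram.flip, slot,
      Equiv.swap_apply_def, h₀, h₁, hi', hj']

theorem diagramClass_mem_range_wheel (h : 2 + 2 = 2 * 2) (D : OpenJacobiDiagram V 2 2) :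
    diagramClass h D ∈ LinearMap.range (colorings K V h wheel) := by
  by_cases hD : (diagramClass h D : B K V 2) = 0
  · rw [hD]; exact zero_mem _
  have hloop := edge_slot_ne_of_ne_zero h hD
  have h₀₁ := edge_inl_ne_inl D
  have h₁₀ : D.edge (Sum.inl 1) ≠ Sum.inl 0 := fun h => h₀₁ (by rw [← h, D.edge_edge])
  obtain ⟨w, i, hi⟩ : ∃ w i, D.edge (Sum.inl 0) = slot w i := by
    rcases hx : D.edge (Sum.inl 0) with u | ⟨w, i⟩
    · fin_cases u
      · exact absurd hx (D.edge_ne _)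
      · exact absurd hx h₀₁
    · exact ⟨w, i, rfl⟩
  obtain ⟨w', j, hj⟩ : ∃ w i, D.edge (Sum.inl 1) = slot w i := by
    rcases hx : D.edge (Sum.inl 1) with u | ⟨w, i⟩
    · fin_cases u
      · exact absurd hx h₁₀
      · exact absurd hx (D.edge_ne _)
    · exact ⟨w, i, rfl⟩
  have hi' : D.edge (slot w i) = Sum.inl 0 := by rw [← hi, D.edge_edge]
  have hj' : D.edge (slot w' j) = Sum.inl 1 := by rw [← hj, D.edge_edge]
  have key : ∀ v k, slot v k ≠ slot w i → slot v k ≠ slot w' j → ∃ t, D.edge (slot v k) =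
      slot (v + 1) t := fun v k h₁ h₂ => by
    rcases hx : D.edge (slot v k) with u | ⟨v', t⟩
    · have hx' := D.edge_edge (slot v k)
      rw [hx] at hx'
      fin_cases u
      · exact absurd (hx'.symm.trans hi) h₁
      · exact absurd (hx'.symm.trans hj) h₂
    · have hv : ∀ v v' : Fin 2, v' = v ∨ v' = v + 1 := by decide
      rcases hv v v' with rfl | rfl
      · exact absurd hx (hloop _ k t)
      · exact ⟨t, rfl⟩
  by_cases hw : w = w'
  · subst hw
    -- Two legs at `w` leave one free slot there, but without loops the other vertex must send all
    -- its half-edges to `w`. Two of them already collide: four distinct elements of `Fin 3` would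
    -- be needed.
    exfalso
    have hk : ∀ (w : Fin 2) (t : Fin 3), slot (m := 2) (w + 1) t ≠ slot w i ∧
        slot (m := 2) (w + 1) t ≠ slot w j := fun w t => by
      have : w + 1 ≠ w := by revert w; decide
      simp [slot, this]
    obtain ⟨a, ha⟩ := key (w + 1) 0 (hk w 0).1 (hk w 0).2
    obtain ⟨b, hb⟩ := key (w + 1) 1 (hk w 1).1 (hk w 1).2
    have hww : ∀ w : Fin 2, w + 1 + 1 = w := by decide
    rw [hww] at ha hb
    have hab : a ≠ b := by
      rintro rfl
      have := D.edge.injective (ha.trans hb.symm)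
      simp [slot] at this
    have hij : i ≠ j := by
      rintro rfl
      have := D.edge.injective (hi.trans hj.symm)
      simp at this
    have hai : ∀ a t, D.edge (slot (w + 1) t) = slot w a → a ≠ i ∧ a ≠ j := by
      intro a t hat
      have hat' := D.edge_edge (slot (w + 1) t)
      rw [hat] at hat'
      constructor
      · rintro rfl; rw [hi'] at hat'; simp [slot] at hat'
      · rintro rfl; rw [hj'] at hat'; simp [slot] at hat'
    have h₄ : ∀ a b i j : Fin 3, ¬(a ≠ b ∧ i ≠ j ∧ (a ≠ i ∧ a ≠ j) ∧ b ≠ i ∧ b ≠ j) := by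
      decide
    exact h₄ a b i j ⟨hab, hij, hai a _ ha, hai b _ hb⟩
  · have hex : ∀ w w' : Fin 2, w ≠ w' → ∃ π : Equiv.Perm (Fin 2), π 0 = w ∧ π 1 = w' := by decide
    obtain ⟨π, hπ₀, hπ₁⟩ := hex w w' hw
    rw [← diagramClass_pull h D π ![i, j]] at hD ⊢
    refine diagramClass_mem_range_wheel_of_edge h _ hD ?_ ?_ <;>
      rw [pull_edge_eq_iff, pullHalfEdge_inl, pullHalfEdge_slot]
    · simp [hπ₀, hi]
    · simp [hπ₁, hj]

/-- Two parallel edges can be arranged in two ways with respect to the slots. -/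
def earEdge (s : Fin 2) : HalfEdge 1 3 → HalfEdge 1 3 :=
  Sum.elim (fun _ => slot 0 0) fun p =>
    match p with
    | (0, 0) => Sum.inl 0
    | (0, 1) => slot 1 0
    | (0, 2) => slot 2 0
    | (1, 0) => slot 0 1
    | (2, 0) => slot 0 2
    | (1, 1) => if s = 0 then slot 2 1 else slot 2 2
    | (1, 2) => if s = 0 then slot 2 2 else slot 2 1
    | (2, 1) => if s = 0 then slot 1 1 else slot 1 2
    | (2, 2) => if s = 0 then slot 1 2 else slot 1 1

theorem diagramClass_eq_zero_of_earEdge (h : 1 + 3 = 2 * 2) (D : OpenJacobiDiagram V 1 3)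
    (s : Fin 2) (hD : ∀ x, D.edge x = earEdge s x) : (diagramClass h D : B K V 2) = 0 := by
  -- Exchanging vertices 1 and 2 preserves the pair of parallel edges in either arrangement, and has
  -- the same effect on the graph as the flip at vertex 0.
  have key : ∀ (s : Fin 2) (x : HalfEdge 1 3),
      earEdge s (pullHalfEdge (Equiv.swap 1 2) 0 x) =
        pullHalfEdge (Equiv.swap 1 2) 0 ((flip 0)⁻¹ (earEdge s (flip 0 x))) := by decide +kernel
  have hcl := diagramClass_pull (K := K) h D (Equiv.swap 1 2) 0
  rw [← hcl]
  refine diagramClass_eq_zero_of_movedBy_flip (D' := D) h 0 ⟨?_, rfl⟩ hcl.symm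
  rw [eq_mul_inv_iff_mul_eq]
  refine Equiv.ext fun x => ?_
  rw [Equiv.Perm.mul_apply, Equiv.Perm.mul_apply, eq_comm, ← Equiv.Perm.eq_inv_iff_eq,
    pull_edge_eq_iff, hD, hD]
  exact key s x

/-- The case of three trivalent vertices, where the leg and the two edges at its vertex lead to
slots `0`. -/
theorem diagramClass_eq_zero_of_edge (h : 1 + 3 = 2 * 2) (D : OpenJacobiDiagram V 1 3)
    (h₀ : D.edge (Sum.inl 0) = slot 0 0) (h₁ : D.edge (slot 0 1) = slot 1 0)
    (h₂ : D.edge (slot 0 2) = slot 2 0) : (diagramClass h D : B K V 2) = 0 := by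
  by_contra hD
  have hloop := edge_slot_ne_of_ne_zero h hD
  have h₀' : D.edge (slot 0 0) = Sum.inl 0 := by rw [← h₀, D.edge_edge]
  have h₁' : D.edge (slot 1 0) = slot 0 1 := by rw [← h₁, D.edge_edge]
  have h₂' : D.edge (slot 2 0) = slot 0 2 := by rw [← h₂, D.edge_edge]
  have key : ∀ i : Fin 3, i ≠ 0 → ∃ j, j ≠ 0 ∧ D.edge (slot 1 i) = slot 2 j := fun i hi => by
    have hx' := D.edge_edge (slot 1 i)
    rcases hx : D.edge (slot 1 i) with u | ⟨w, j⟩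
    · rw [hx, Subsingleton.elim u 0] at hx'
      exact absurd (h₀.symm.trans hx') (by simp [slot])
    · rw [hx] at hx'
      fin_cases w
      · fin_cases j
        · exact absurd (h₀'.symm.trans hx') (by simp [slot])
        · exact absurd (h₁.symm.trans hx') (by simp [slot, hi.symm])
        · exact absurd (h₂.symm.trans hx') (by simp [slot])
      · exact absurd hx (hloop 1 i j)
      · refine ⟨j, ?_, rfl⟩
        rintro rfl
        exact absurd (h₂'.symm.trans hx') (by simp [slot])
  obtain ⟨i, hi, hi'⟩ := key 1 (by decide)
  obtain ⟨j, hj, hj'⟩ := key 2 (by decide)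
  have hij : i ≠ j := by
    rintro rfl
    have := D.edge.injective (hi'.trans hj'.symm)
    simp [slot] at this
  have hi'' : D.edge (slot 2 i) = slot 1 1 := by rw [← hi', D.edge_edge]
  have hj'' : D.edge (slot 2 j) = slot 1 2 := by rw [← hj', D.edge_edge]
  have hcases : ∀ i j : Fin 3, i ≠ 0 → j ≠ 0 → i ≠ j → (i = 1 ∧ j = 2) ∨ (i = 2 ∧ j = 1) := by
    decide
  rcases hcases i j hi hj hij with ⟨rfl, rfl⟩ | ⟨rfl, rfl⟩
  · refine hD (diagramClass_eq_zero_of_earEdge h D 0 fun x => ?_)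
    rcases x with u | ⟨w, i⟩
    · rw [Subsingleton.elim u 0]; exact h₀
    · fin_cases w <;> fin_cases i
      exacts [h₀', h₁, h₂, h₁', hi', hj', h₂', hi'', hj'']
  · refine hD (diagramClass_eq_zero_of_earEdge h D 1 fun x => ?_)
    rcases x with u | ⟨w, i⟩
    · rw [Subsingleton.elim u 0]; exact h₀
    · fin_cases w <;> fin_cases i
      exacts [h₀', h₁, h₂, h₁', hi', hj', h₂', hj'', hi'']

/-- Without loops, the vertex of the leg has two further edges. If they end at the same vertex, the
last vertex has too few slots to attach to; otherwise a relabelling leads to the shape `earEdge`. -/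
theorem diagramClass_eq_zero_of_one_three (h : 1 + 3 = 2 * 2) (D : OpenJacobiDiagram V 1 3) :
    (diagramClass h D : B K V 2) = 0 := by
  by_contra hD
  have hloop := edge_slot_ne_of_ne_zero h hD
  obtain ⟨w, i, hi⟩ : ∃ w i, D.edge (Sum.inl 0) = slot w i := by
    rcases hx : D.edge (Sum.inl 0) with u | ⟨w, i⟩
    · exact absurd (by rw [hx, Subsingleton.elim u 0]) (D.edge_ne (Sum.inl 0))
    · exact ⟨w, i, rfl⟩
  have hi' : D.edge (slot w i) = Sum.inl 0 := by rw [← hi, D.edge_edge]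
  have key : ∀ v k, slot v k ≠ slot w i → ∃ v' t, v' ≠ v ∧ D.edge (slot v k) = slot v' t :=
    fun v k h₁ => by
      rcases hx : D.edge (slot v k) with u | ⟨v', t⟩
      · have hx' := D.edge_edge (slot v k)
        rw [hx, Subsingleton.elim u 0] at hx'
        exact absurd (hx'.symm.trans hi) h₁
      · refine ⟨v', t, ?_, rfl⟩
        rintro rfl
        exact hloop _ k t hx
  have hs : ∀ i : Fin 3, i + 1 ≠ i ∧ i + 2 ≠ i ∧ i + 1 ≠ i + 2 := by decide
  obtain ⟨a, p, ha, hp⟩ := key w (i + 1) (by simp [slot])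
  obtain ⟨b, q, hb, hq⟩ := key w (i + 2) (by simp [slot])
  have hp' : D.edge (slot a p) = slot w (i + 1) := by rw [← hp, D.edge_edge]
  have hq' : D.edge (slot b q) = slot w (i + 2) := by rw [← hq, D.edge_edge]
  by_cases hab : a = b
  · subst hab
    have hpq : p ≠ q := by
      rintro rfl
      have := D.edge.injective (hp.trans hq.symm)
      simp [slot] at this
    -- The third vertex `c` would have only the third slot of `a` to connect to.
    have hc : ∀ a w : Fin 3, a ≠ w → ∃ c, c ≠ a ∧ c ≠ w ∧ ∀ v, v = w ∨ v = a ∨ v = c := by decide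
    obtain ⟨c, hca, hcw, hall⟩ := hc a w ha
    have key' : ∀ k, ∃ t, t ≠ p ∧ t ≠ q ∧ D.edge (slot c k) = slot a t := fun k => by
      obtain ⟨v', t, hv', hx⟩ := key c k (slot_ne_slot hcw k i)
      have hx' := D.edge_edge (slot c k)
      rw [hx] at hx'
      rcases hall v' with rfl | rfl | rfl
      · have ht : ∀ i t : Fin 3, t = i ∨ t = i + 1 ∨ t = i + 2 := by decide
        rcases ht i t with rfl | rfl | rfl
        · exact absurd (hi'.symm.trans hx') (by simp [slot])
        · exact absurd (hp.symm.trans hx') (slot_ne_slot hca.symm _ _)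
        · exact absurd (hq.symm.trans hx') (slot_ne_slot hca.symm _ _)
      · refine ⟨t, ?_, ?_, hx⟩
        · rintro rfl
          exact absurd (hp'.symm.trans hx') (slot_ne_slot hcw.symm _ _)
        · rintro rfl
          exact absurd (hq'.symm.trans hx') (slot_ne_slot hcw.symm _ _)
      · exact absurd rfl hv'
    obtain ⟨s, hsp, hsq, hs'⟩ := key' 0
    obtain ⟨t, htp, htq, ht'⟩ := key' 1
    have hst : s ≠ t := by
      rintro rfl
      have := D.edge.injective (hs'.trans ht'.symm)
      simp [slot] at this
    have h₄ : ∀ a b i j : Fin 3, ¬(a ≠ b ∧ i ≠ j ∧ (a ≠ i ∧ a ≠ j) ∧ b ≠ i ∧ b ≠ j) := by decide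
    exact h₄ s t p q ⟨hst, hpq, ⟨hsp, hsq⟩, htp, htq⟩
  · have hex : ∀ w a b : Fin 3, w ≠ a → w ≠ b → a ≠ b →
        ∃ π : Equiv.Perm (Fin 3), π 0 = w ∧ π 1 = a ∧ π 2 = b := by decide +kernel
    obtain ⟨π, hπ₀, hπ₁, hπ₂⟩ := hex w a b ha.symm hb.symm hab
    rw [← diagramClass_pull h D π ![i, p, q]] at hD
    refine hD (diagramClass_eq_zero_of_edge h _ ?_ ?_ ?_) <;>
      rw [pull_edge_eq_iff, pullHalfEdge_slot]
    · simp [pullHalfEdge_inl, hπ₀, hi]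
    · simp [pullHalfEdge_slot, hπ₀, hπ₁, hp]
    · simp [pullHalfEdge_slot, hπ₀, hπ₂, hq]

/-- Four vertices leave `k ≤ 4`. Diagrams with `k = 3` vanish, and `k = 4` is excluded since each
component needs a univalent vertex. -/
theorem iSup_BGraded (K : Type*) [Field K] [CharZero K] (V : Type*) [AddCommGroup V] [Module K V] :
    ⨆ k : Fin 3, (BGraded K V 2 k).toSubmodule = ⊤ := by
  have hle (k : Fin 3) (m : ℕ) (h : m + (k : ℕ) = 2 * 2) (D : OpenJacobiDiagram V m k) :
      (diagramClass h D : B K V 2) ∈ ⨆ k : Fin 3, (BGraded K V 2 k).toSubmodule :=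
    Submodule.mem_iSup_of_mem k (Submodule.subset_span ⟨m, h, D, rfl⟩)
  have hall (m k : ℕ) (h : m + k = 2 * 2) (D : OpenJacobiDiagram V m k) :
      (diagramClass h D : B K V 2) ∈ ⨆ k : Fin 3, (BGraded K V 2 k).toSubmodule := by
    obtain hk | rfl | rfl : k < 3 ∨ k = 3 ∨ k = 4 := by omega
    · exact hle ⟨k, hk⟩ m h D
    · obtain rfl : m = 1 := by omega
      rw [diagramClass_eq_zero_of_one_three]
      exact zero_mem _
    · obtain rfl : m = 0 := by omega
      exact (D.exists_univalent (Sum.inr 0)).choose.elim0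
  rw [← (Submodule.ker_mkQ (⨆ k : Fin 3, (BGraded K V 2 k).toSubmodule)), LinearMap.ker_eq_top]
  refine B.ext_diagramClass fun m k h D => ?_
  rw [LinearMap.zero_apply, Submodule.mkQ_apply, Submodule.Quotient.mk_eq_zero]
  exact hall m k h D

end Classification

/-! ### The decomposition and the identification of its summands. -/

section Main

variable {K : Type*} [Field K] {V : Type*} [AddCommGroup V] [Module K V]

theorem colorings_weight_twoStruts (h : 4 + 0 = 2 * 2) (t : ⨂[K] _ : Fin 4, V) :
    colorings K V h twoStruts (B.weight 2 squareRow (colorings K V h twoStruts t)) =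
      (8 : K) • colorings K V h twoStruts t := by
  rw [colorings_weight_colorings h twoStruts squareRow dihedralWeight fun τ v => ?_,
    sum_dihedralWeight, Int.cast_ofNat]
  rw [graphWeight_twoStruts, dihedralWeight_eq]
  split_ifs with hτ
  · rw [diagramClass_twoStruts_comp h τ hτ]
  · simp

theorem colorings_weight_tripod (h : 3 + 1 = 2 * 2) (t : ⨂[K] _ : Fin 3, V) :
    colorings K V h tripod (B.weight 2 id (colorings K V h tripod t)) =
      (6 : K) • colorings K V h tripod t := by
  rw [colorings_weight_colorings h tripod id (fun _ => 1) fun τ v => ?_]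
  · simp [Fintype.card_perm, Nat.factorial]
  rw [graphWeight_tripod, diagramClass_tripod_comp, smul_smul, ← Int.cast_mul, ← Units.val_mul,
    Int.units_mul_self, Units.val_one]

theorem colorings_weight_wheel (h : 2 + 2 = 2 * 2) (t : ⨂[K] _ : Fin 2, V) :
    colorings K V h wheel (B.weight 2 (fun _ => 0) (colorings K V h wheel t)) =
      (4 : K) • colorings K V h wheel t := by
  rw [colorings_weight_colorings h wheel (fun _ => 0) (fun _ => 2) fun τ v => ?_]
  · norm_num [Fintype.card_perm, Nat.factorial]
  rw [graphWeight_wheel, diagramClass_wheel_comp]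

theorem B.eq_zero_of_weight_eq_zero {m k d : ℕ} {C : Type*} (h : m + k = 2 * d)
    (R : OpenJacobiDiagram C m k) (φ : Fin m → Fin 3)
    (hR : (BGraded K V d k).toSubmodule = LinearMap.range (colorings K V h R)) {c : K} (hc : c ≠ 0)
    (hcol : ∀ t, colorings K V h R (B.weight d φ (colorings K V h R t)) =
      c • colorings K V h R t)
    (x : B K V d) (hx : x ∈ (BGraded K V d k).toSubmodule) (hw : B.weight d φ x = 0) : x = 0 := by
  rw [hR] at hx
  obtain ⟨t, rfl⟩ := hx
  have := hcol t
  rw [hw, map_zero] at this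
  exact (smul_eq_zero.1 this.symm).resolve_left hc

variable (K V)

theorem BGraded_two_zero (h : 4 + 0 = 2 * 2) :
    (BGraded K V 2 0).toSubmodule = LinearMap.range (colorings K V h twoStruts) :=
  BGraded_eq_range h twoStruts (diagramClass_mem_range_twoStruts h)

variable [CharZero K]

theorem BGraded_two_one (h : 3 + 1 = 2 * 2) :
    (BGraded K V 2 1).toSubmodule = LinearMap.range (colorings K V h tripod) :=
  BGraded_eq_range h tripod (diagramClass_mem_range_tripod h)

theorem BGraded_two_two (h : 2 + 2 = 2 * 2) :
    (BGraded K V 2 2).toSubmodule = LinearMap.range (colorings K V h wheel) :=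
  BGraded_eq_range h wheel (diagramClass_mem_range_wheel h)

/-- The weight with `4 - k` legs vanishes on all the other pieces and is injective on the `k`-th
one. -/
theorem iSupIndep_BGraded : iSupIndep fun k : Fin 3 => (BGraded K V 2 k).toSubmodule := by
  intro k
  rw [Submodule.disjoint_def]
  intro x hx hx'
  have hzero (n : ℕ) (φ : Fin n → Fin 3) (hn : n + k = 2 * 2) : B.weight 2 φ x = 0 := by
    have : (⨆ j, ⨆ (_ : j ≠ k), (BGraded K V 2 j).toSubmodule) ≤ LinearMap.ker (B.weight 2 φ) :=
      iSup₂_le fun j hj y hy => B.weight_eq_zero φ j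
        (fun h => hj (Fin.ext (by omega))) y hy
    exact this hx'
  fin_cases k
  · exact B.eq_zero_of_weight_eq_zero rfl twoStruts squareRow (BGraded_two_zero K V rfl)
      (by norm_num) (colorings_weight_twoStruts rfl) x hx (hzero 4 _ rfl)
  · exact B.eq_zero_of_weight_eq_zero rfl tripod id (BGraded_two_one K V rfl)
      (by norm_num) (colorings_weight_tripod rfl) x hx (hzero 3 _ rfl)
  · exact B.eq_zero_of_weight_eq_zero rfl wheel (fun _ => 0) (BGraded_two_two K V rfl)
      (by norm_num) (colorings_weight_wheel rfl) x hx (hzero 2 _ rfl)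

theorem isInternal_BGraded :
    DirectSum.IsInternal fun k : Fin 3 => (BGraded K V 2 k).toSubmodule :=
  (DirectSum.isInternal_submodule_iff_iSupIndep_and_iSup_eq_top _).2
    ⟨iSupIndep_BGraded K V, iSup_BGraded K V⟩

theorem nonempty_equiv_BGraded_two_zero :
    Nonempty ((BGraded K V 2 0).toRepresentation.Equiv
      ((schurRep K V [4] (by decide)).prod (schurRep K V [2, 2] (by decide)))) :=
  nonempty_equiv_schur_prod (BGraded K V 2 0) (colorings K V rfl twoStruts)
    (B.weight 2 squareRow) (BGraded_two_zero K V rfl) (B.weight_BRep squareRow) (c := 8)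
    (by norm_num) (colorings_weight_twoStruts rfl) fun t => by
      rw [weight_colorings, funext graphWeight_twoStruts]

theorem nonempty_equiv_BGraded_two_one :
    Nonempty ((BGraded K V 2 1).toRepresentation.Equiv (schurRep K V [1, 1, 1] (by decide))) := by
  obtain ⟨e, he⟩ := schur_one_one_one K V
  refine nonempty_equiv_schur (BGraded K V 2 1) _ e _ he (colorings K V rfl tripod)
    (B.weight 2 id) (BGraded_two_one K V rfl) (B.weight_BRep id) (c := 6) (r := 1)
    (by norm_num) one_ne_zero (colorings_weight_tripod rfl) fun t => ?_
  rw [weight_colorings, funext graphWeight_tripod, one_smul]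

theorem nonempty_equiv_BGraded_two_two :
    Nonempty ((BGraded K V 2 2).toRepresentation.Equiv (schurRep K V [2] (by decide))) := by
  obtain ⟨e, he⟩ := schur_two K V
  refine nonempty_equiv_schur (BGraded K V 2 2) _ e _ he (colorings K V rfl wheel)
    (B.weight 2 fun _ => 0) (BGraded_two_two K V rfl) (B.weight_BRep _) (c := 4) (r := 2)
    (by norm_num) two_ne_zero (colorings_weight_wheel rfl) fun t => ?_
  rw [weight_colorings, funext graphWeight_wheel,
    symmetrize_mul_left (a := 2) (w := fun _ => 2) (w₁ := fun _ => 1) fun _ => rfl]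
  simp

end Main

end JacobiDiagram

end

theorem mainTheorem8 (K : Type*) [Field K] [CharZero K]
    (V : Type*) [AddCommGroup V] [Module K V] [FiniteDimensional K V] :
    DirectSum.IsInternal (fun k : Fin 3 => (JacobiDiagram.BGraded K V 2 k).toSubmodule) ∧
    Nonempty ((JacobiDiagram.BGraded K V 2 0).toRepresentation.Equiv
      ((JacobiDiagram.schurRep K V [4] (by decide)).prod
        (JacobiDiagram.schurRep K V [2, 2] (by decide)))) ∧
    ((JacobiDiagram.BGraded K V 2 1).toSubmodule = JacobiDiagram.BConnected K V 2 1 ∧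
      Nonempty ((JacobiDiagram.BGraded K V 2 1).toRepresentation.Equiv
        (JacobiDiagram.schurRep K V [1, 1, 1] (by decide)))) ∧
    ((JacobiDiagram.BGraded K V 2 2).toSubmodule = JacobiDiagram.BConnected K V 2 2 ∧
      Nonempty ((JacobiDiagram.BGraded K V 2 2).toRepresentation.Equiv
        (JacobiDiagram.schurRep K V [2] (by decide)))) :=
  ⟨JacobiDiagram.isInternal_BGraded K V,
    JacobiDiagram.nonempty_equiv_BGraded_two_zero K V,
    ⟨JacobiDiagram.BGraded_eq_BConnected rfl JacobiDiagram.tripod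
      (JacobiDiagram.diagramClass_mem_range_tripod rfl) JacobiDiagram.tripod_isConnected,
      JacobiDiagram.nonempty_equiv_BGraded_two_one K V⟩,
    ⟨JacobiDiagram.BGraded_eq_BConnected rfl JacobiDiagram.wheel
      (JacobiDiagram.diagramClass_mem_range_wheel rfl) JacobiDiagram.wheel_isConnected,
      JacobiDiagram.nonempty_equiv_BGraded_two_two K V⟩⟩
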